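/- For integers $n\ge 0$ and $k,l\ge 2$ let $f(n,k,l)$ be the minimum number of copies of $K_k$ in a graph on $n$ vertices that has no independent set of size $l$. A blow-up of the cycle $C_5$ with parts $V_1,\dots,V_5$ (indices modulo $5$) is the graph on the disjoint union $V_1\cup\dots\cup V_5$ in which each $V_i\cup V_{i+1}$ is a clique and there are no edges between $V_i$ and $V_{i+2}$. Then $$f(n,4,3)=\frac{3}{25}\binom{n}{4}+O(n^3).$$ Moreover, for all sufficiently large $n$, there is, up to isomorphism, exactly one graph on $n$ vertices with independence number at most $2$ that has exactly $f(n,4,3)$ copies of $K_4$, namely the blow-up of $C_5$ whose part sizes $(|V_1|,|V_2|,|V_3|,|V_4|,|V_5|)$ are - $(k,\,k,\,k,\,k,\,k)$ if $n=5k$, - $(k,\,k,\,k+1,\,k-1,\,k+1)$ if $n=5k+1$, - $(k,\,k,\,k+1,\,k,\,k+1)$ if $n=5k+2$, - $(k+1,\,k+1,\,k,\,k+1,\,k)$ if $n=5k+3$, - $(k+1,\,k+1,\,k,\,k+2,\,k)$ if $n=5k+4$. -/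

import Mathlib

/-- The number `t_k(G)` of `k`-cliques of `G`. -/
noncomputable def cliqueCount {V : Type*} (G : SimpleGraph V) (k : ℕ) : ℕ :=
  (G.cliqueSet k).ncard

/-- `f(n, k, l)`: the minimum number of `k`-cliques in a graph on `n` vertices that has no
independent set of size `l`. (For `l ≥ 2` the minimum is attained, see `minCliques_attained`.) -/
noncomputable def minCliques (n k l : ℕ) : ℕ :=
  sInf {t : ℕ | ∃ G : SimpleGraph (Fin n), G.IndepSetFree l ∧ cliqueCount G k = t}

theorem minCliques_attained (n k l : ℕ) (hl : 2 ≤ l) :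
    ∃ G : SimpleGraph (Fin n), G.IndepSetFree l ∧ cliqueCount G k = minCliques n k l := by
  refine Nat.sInf_mem (s := {t : ℕ | ∃ G : SimpleGraph (Fin n),
    G.IndepSetFree l ∧ cliqueCount G k = t}) ⟨_, ⊤, ?_, rfl⟩
  rw [← SimpleGraph.cliqueFree_compl, compl_top]
  exact SimpleGraph.cliqueFree_bot hl

/-- The blow-up of `H` in which the vertex `v` is replaced by a clique of size `m v` and every
edge of `H` by a complete bipartite graph (non-adjacent vertices of `H` give no edges). -/
def blowUp {W : Type*} (H : SimpleGraph W) (m : W → ℕ) :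
    SimpleGraph (Σ v : W, Fin (m v)) where
  Adj x y := x ≠ y ∧ (x.1 = y.1 ∨ H.Adj x.1 y.1)
  symm := ⟨fun _ _ h => ⟨h.1.symm, h.2.imp Eq.symm SimpleGraph.Adj.symm⟩⟩
  loopless := ⟨fun _ h => h.1 rfl⟩

/-- The five part sizes `|V₁|, …, |V₅|` (in cyclic order), with `k = ⌊n / 5⌋`.
The subtraction `k - 1` is the true one as soon as `n ≥ 5`. -/
def partSizes (n : ℕ) : Fin 5 → ℕ :=
  let k := n / 5
  match n % 5 with
  | 0 => ![k, k, k, k, k]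
  | 1 => ![k, k, k + 1, k - 1, k + 1]
  | 2 => ![k, k, k + 1, k, k + 1]
  | 3 => ![k + 1, k + 1, k, k + 1, k]
  | _ => ![k + 1, k + 1, k, k + 2, k]

/-! Pass to the complement, written as a Boolean relation `e`. It is triangle-free, and copies of K₄
in the graph become independent quadruples of `e`. Sums run over all tuples of vertices, repetitions
included, so products of counts are exact; the number T of independent ordered quadruples exceeds 24
times the clique count by at most 6n³.

The lower bound is a flag-algebra argument. An explicit sum of squares on five labelled vertices,
verified on every triangle-free pattern, gives 25T ≥ 3n⁴. `indep_quadruple_bound` keeps two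
nonnegative terms as slack: the squared deviations of the degrees from 2n/5, and the number of
induced paths abcd with a further vertex missing a, b and c. Both vanish on the balanced blow-up of
C₅. Counting cliques in the blow-up gives the matching upper bound.

Uniqueness is a stability argument. In a near-extremal graph the slack is small while induced paths
on four vertices are plentiful (`path_quadruple_bound`), so some path has only small defects
(`exists_typical_path`), and its neighbourhoods cut out an approximate blow-up of C₅
(`exists_nearBlowUp_of_path`). In an extremal graph all vertices lie in about equally many cliques,
since otherwise one could be replaced by a clone of another (`card_cliquesAt_le_add`). Hence every
vertex, with no exceptions, attaches to the approximate structure like one of its classes, and `e`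
maps homomorphically to C₅ (`NearBlowUp.exists_hom`).

As C₅ is self-complementary, the graph then contains a blow-up of C₅ with nearly equal parts. By
minimality that blow-up is extremal itself. Expanding its clique count around n/5 reduces the choice
of part sizes to a quadratic form over the integers (`eq_partSizes_of_blowUpCount_le`), and an
additional edge would create a new K₄ (`eq_cycleBlowUp_of_cliqueCount_le`). -/

/-! ### A sum-of-squares certificate on triangle-free patterns of five vertices -/

/-- Value at a root `r` and a pair `x, y`, where `a`, `b`, `c` tell whether `xy`, `rx`, `ry`
are edges. -/
def pairForm (v₀ v₁ v₂ v₃ v₄ : ℤ) (a b c : Bool) : ℤ :=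
  bif b then (bif c then v₄ else bif a then v₃ else v₂)
  else bif c then (bif a then v₃ else v₂) else bif a then v₁ else v₀

/-- Value at a vertex `x` and a root triple spanning exactly the edge of its first two vertices,
where `a`, `b`, `c` tell which roots are adjacent to `x`. -/
def edgeForm (v₀ v₁ v₂ v₃ v₁₃ v₂₃ : ℤ) (a b c : Bool) : ℤ :=
  bif c then (bif a then v₁₃ else bif b then v₂₃ else v₃)
  else bif a then v₁ else bif b then v₂ else v₀

/-- Value at a vertex `x` and an independent root triple, depending on the number of roots
adjacent to `x`. -/
def indepForm (v₀ v₁ v₂ v₃ : ℤ) (a b c : Bool) : ℤ :=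
  bif a then (bif b then (bif c then v₃ else v₂) else bif c then v₂ else v₁)
  else bif b then (bif c then v₂ else v₁) else bif c then v₁ else v₀

/-- The indicator of a pattern on `0, …, 4` in which `0123` is an induced path and `4` is adjacent
to none of `0, 1, 2`. -/
def pathDefect (b01 b02 b03 b04 b12 b13 b14 b23 b24 : Bool) : Bool :=
  b01 && b12 && b23 && !b02 && !b03 && !b13 && !b04 && !b14 && !b24

/-- The sum of the squares in the certificate, before symmetrization. -/
def squarePart (b01 b02 b03 b04 b12 b13 b14 b23 b24 b34 : Bool) : ℤ :=
  2027655 * (pairForm 0 2 (-1) 1 (-2) b12 b01 b02 * pairForm 0 2 (-1) 1 (-2) b34 b03 b04) +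
  5739510 * (pairForm 2 1 (-2) 0 (-2) b12 b01 b02 * pairForm 2 1 (-2) 0 (-2) b34 b03 b04) +
  262800 * (pairForm 2 1 (-1) 0 (-3) b12 b01 b02 * pairForm 2 1 (-1) 0 (-3) b34 b03 b04) +
  664680 * (pairForm 2 3 (-2) 0 (-3) b12 b01 b02 * pairForm 2 3 (-2) 0 (-3) b34 b03 b04) +
  (bif b01 && !b02 && !b12 then 38602320 else 0) *
    (edgeForm 0 1 (-1) 0 1 (-1) b03 b13 b23 * edgeForm 0 1 (-1) 0 1 (-1) b04 b14 b24) +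
  (bif b01 && !b02 && !b12 then 401280 else 0) *
    (edgeForm 6 0 0 1 (-3) (-3) b03 b13 b23 * edgeForm 6 0 0 1 (-3) (-3) b04 b14 b24) +
  (bif b01 || b02 || b12 then 0 else 580208) *
    (indepForm 2 4 (-5) (-3) b03 b13 b23 * indepForm 2 4 (-5) (-3) b04 b14 b24) +
  (bif b01 || b02 || b12 then 0 else 352408) *
    (indepForm 4 3 (-5) (-6) b03 b13 b23 * indepForm 4 3 (-5) (-6) b04 b14 b24)

/-- The certificate before symmetrization. -/
def certificate (b01 b02 b03 b04 b12 b13 b14 b23 b24 b34 : Bool) : ℤ :=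
  1585500 * (25 * (bif b01 || b02 || b12 || b03 || b13 || b23 then 0 else 1) - 3
    - (bif pathDefect b01 b02 b03 b04 b12 b13 b14 b23 b24 then 1 else 0))
  - 63420 * ((bif b01 then 3 else -2) * (bif b02 then 3 else -2))
  - squarePart b01 b02 b03 b04 b12 b13 b14 b23 b24 b34

/-- The certificate symmetrized over the first two vertices. -/
def certificate₂ (b01 b02 b03 b04 b12 b13 b14 b23 b24 b34 : Bool) : ℤ :=
  certificate b01 b02 b03 b04 b12 b13 b14 b23 b24 b34 +
  certificate b01 b12 b13 b14 b02 b03 b04 b23 b24 b34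

/-- The certificate symmetrized over the first three vertices. -/
def certificate₃ (b01 b02 b03 b04 b12 b13 b14 b23 b24 b34 : Bool) : ℤ :=
  certificate₂ b01 b02 b03 b04 b12 b13 b14 b23 b24 b34 +
  certificate₂ b12 b02 b23 b24 b01 b13 b14 b03 b04 b34 +
  certificate₂ b02 b01 b03 b04 b12 b23 b24 b13 b14 b34

/-- The certificate symmetrized over the first four vertices. -/
def certificate₄ (b01 b02 b03 b04 b12 b13 b14 b23 b24 b34 : Bool) : ℤ :=
  certificate₃ b01 b02 b03 b04 b12 b13 b14 b23 b24 b34 +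
  certificate₃ b13 b23 b03 b34 b12 b01 b14 b02 b24 b04 +
  certificate₃ b03 b02 b01 b04 b23 b13 b34 b12 b24 b14 +
  certificate₃ b01 b03 b02 b04 b13 b12 b14 b23 b34 b24

/-- The certificate symmetrized over the first five vertices. -/
def certificate₅ (b01 b02 b03 b04 b12 b13 b14 b23 b24 b34 : Bool) : ℤ :=
  certificate₄ b01 b02 b03 b04 b12 b13 b14 b23 b24 b34 +
  certificate₄ b14 b24 b34 b04 b12 b13 b01 b23 b02 b03 +
  certificate₄ b04 b02 b03 b01 b24 b34 b14 b23 b12 b13 +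
  certificate₄ b01 b04 b03 b02 b14 b13 b12 b34 b24 b23 +
  certificate₄ b01 b02 b04 b03 b12 b14 b13 b24 b23 b34

/-- Whether `p` holds for both truth values. -/
def allBool (p : Bool → Bool) : Bool := p true && p false

theorem allBool_iff {p : Bool → Bool} : allBool p = true ↔ ∀ b, p b = true := by
  simp [allBool, and_comm]

/-- Whether a pattern on five vertices contains a triangle. -/
def hasTriangle (b01 b02 b03 b04 b12 b13 b14 b23 b24 b34 : Bool) : Bool :=
  (b01 && b02 && b12) || (b01 && b03 && b13) || (b01 && b04 && b14) || (b02 && b03 && b23) ||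
  (b02 && b04 && b24) || (b03 && b04 && b34) || (b12 && b13 && b23) || (b12 && b14 && b24) ||
  (b13 && b14 && b34) || (b23 && b24 && b34)

/-- The certificate is nonnegative only after averaging over the 5! labellings. What remains is a
finite check over 2¹⁰ patterns, made by evaluating one Boolean expression. -/
theorem certificate₅_nonneg (b01 b02 b03 b04 b12 b13 b14 b23 b24 b34 : Bool)
    (h : hasTriangle b01 b02 b03 b04 b12 b13 b14 b23 b24 b34 = false) :
    0 ≤ certificate₅ b01 b02 b03 b04 b12 b13 b14 b23 b24 b34 := by
  have key : (allBool fun b01 => allBool fun b02 => allBool fun b03 => allBool fun b04 =>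
      allBool fun b12 => allBool fun b13 => allBool fun b14 => allBool fun b23 =>
      allBool fun b24 => allBool fun b34 =>
      hasTriangle b01 b02 b03 b04 b12 b13 b14 b23 b24 b34 ||
        decide (0 ≤ certificate₅ b01 b02 b03 b04 b12 b13 b14 b23 b24 b34)) = true := by
    decide +kernel
  simp only [allBool_iff] at key
  have := key b01 b02 b03 b04 b12 b13 b14 b23 b24 b34
  rw [h, Bool.false_or] at this
  exact of_decide_eq_true this

/-! ### Summing the certificate over all five-tuples of vertices -/

section Patterns

variable {V : Type*} [Fintype V]

theorem sum_fin_succ_arrow {M : Type*} [AddCommMonoid M] {n : ℕ} (F : (Fin (n + 1) → V) → M) :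
    ∑ f, F f = ∑ a, ∑ g : Fin n → V, F (Fin.cons a g) := by
  rw [← (Fin.consEquiv (fun _ => V)).sum_comp, Fintype.sum_prod_type]
  rfl

theorem sum_fin_five_arrow {M : Type*} [AddCommMonoid M] (F : V → V → V → V → V → M) :
    ∑ f : Fin 5 → V, F (f 0) (f 1) (f 2) (f 3) (f 4) =
      ∑ a, ∑ b, ∑ c, ∑ d, ∑ x, F a b c d x := by
  simp only [sum_fin_succ_arrow, Finset.univ_unique, Finset.sum_singleton]
  rfl

theorem sum_fin_four_arrow {M : Type*} [AddCommMonoid M] (F : V → V → V → V → M) :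
    ∑ f : Fin 4 → V, F (f 0) (f 1) (f 2) (f 3) = ∑ a, ∑ b, ∑ c, ∑ d, F a b c d := by
  simp only [sum_fin_succ_arrow, Finset.univ_unique, Finset.sum_singleton]
  rfl

theorem sum_comp_swap {M : Type*} [AddCommMonoid M] {n : ℕ} (F : (Fin n → V) → M) (i j : Fin n) :
    ∑ f, F (f ∘ Equiv.swap i j) = ∑ f, F f :=
  ((Equiv.swap i j).arrowCongr (Equiv.refl V)).sum_comp F

/-- The pattern which `e` induces on five vertices. -/
def pattern (e : V → V → Bool) {α : Type*}
    (A : Bool → Bool → Bool → Bool → Bool → Bool → Bool → Bool → Bool → Bool → α)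
    (f : Fin 5 → V) : α :=
  A (e (f 0) (f 1)) (e (f 0) (f 2)) (e (f 0) (f 3)) (e (f 0) (f 4)) (e (f 1) (f 2))
    (e (f 1) (f 3)) (e (f 1) (f 4)) (e (f 2) (f 3)) (e (f 2) (f 4)) (e (f 3) (f 4))

variable {e : V → V → Bool}

/-- Here and in the next three lemmas, the identity and the swaps of the new label with the earlier
ones are coset representatives for one symmetric group in the next. Each swap permutes the tuples,
so symmetrizing only multiplies the total. -/
theorem sum_pattern_certificate₂ (he : ∀ x y, e x y = e y x) :
    ∑ f, pattern e certificate₂ f = 2 * ∑ f, pattern e certificate f := by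
  have key : ∀ f, pattern e certificate₂ f = pattern e certificate f
      + pattern e certificate (f ∘ Equiv.swap 0 1) := by
    intro f
    simp only [pattern, certificate₂, Function.comp_apply, Equiv.swap_apply_def, Fin.reduceEq,
      if_true, if_false, he (f 1) (f 0)]
  simp only [key, Finset.sum_add_distrib, sum_comp_swap]
  ring

theorem sum_pattern_certificate₃ (he : ∀ x y, e x y = e y x) :
    ∑ f, pattern e certificate₃ f = 3 * ∑ f, pattern e certificate₂ f := by
  have key : ∀ f, pattern e certificate₃ f = pattern e certificate₂ f
      + pattern e certificate₂ (f ∘ Equiv.swap 0 2)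
      + pattern e certificate₂ (f ∘ Equiv.swap 1 2) := by
    intro f
    simp only [pattern, certificate₃, Function.comp_apply, Equiv.swap_apply_def, Fin.reduceEq,
      if_true, if_false, he (f 1) (f 0), he (f 2) (f 0), he (f 2) (f 1)]
  simp only [key, Finset.sum_add_distrib, sum_comp_swap]
  ring

theorem sum_pattern_certificate₄ (he : ∀ x y, e x y = e y x) :
    ∑ f, pattern e certificate₄ f = 4 * ∑ f, pattern e certificate₃ f := by
  have key : ∀ f, pattern e certificate₄ f = pattern e certificate₃ f
      + pattern e certificate₃ (f ∘ Equiv.swap 0 3)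
      + pattern e certificate₃ (f ∘ Equiv.swap 1 3)
      + pattern e certificate₃ (f ∘ Equiv.swap 2 3) := by
    intro f
    simp only [pattern, certificate₄, Function.comp_apply, Equiv.swap_apply_def, Fin.reduceEq,
      if_true, if_false, he (f 1) (f 0), he (f 2) (f 0), he (f 3) (f 0), he (f 2) (f 1), he (f 3) (f 1),
      he (f 3) (f 2)]
  simp only [key, Finset.sum_add_distrib, sum_comp_swap]
  ring

theorem sum_pattern_certificate₅ (he : ∀ x y, e x y = e y x) :
    ∑ f, pattern e certificate₅ f = 5 * ∑ f, pattern e certificate₄ f := by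
  have key : ∀ f, pattern e certificate₅ f = pattern e certificate₄ f
      + pattern e certificate₄ (f ∘ Equiv.swap 0 4)
      + pattern e certificate₄ (f ∘ Equiv.swap 1 4)
      + pattern e certificate₄ (f ∘ Equiv.swap 2 4)
      + pattern e certificate₄ (f ∘ Equiv.swap 3 4) := by
    intro f
    simp only [pattern, certificate₅, Function.comp_apply, Equiv.swap_apply_def, Fin.reduceEq,
      if_true, if_false, he (f 1) (f 0), he (f 2) (f 0), he (f 3) (f 0), he (f 4) (f 0), he (f 2) (f 1),
      he (f 3) (f 1), he (f 4) (f 1), he (f 3) (f 2), he (f 4) (f 2), he (f 4) (f 3)]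
  simp only [key, Finset.sum_add_distrib, sum_comp_swap]
  ring

theorem sum_pattern_certificate_nonneg (he : ∀ x y, e x y = e y x)
    (ht : ∀ x y z, e x y = true → e x z = true → e y z = false) :
    0 ≤ ∑ f, pattern e certificate f := by
  have h : 0 ≤ ∑ f, pattern e certificate₅ f := by
    refine Finset.sum_nonneg fun f _ => certificate₅_nonneg _ _ _ _ _ _ _ _ _ _ ?_
    -- The hypothesis `ht` does not require distinct vertices, so tuples with repetitions are
    -- triangle-free patterns too.
    have ht' : ∀ x y z, (e x y && e x z && e y z) = false := by
      intro x y z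
      by_contra h
      simp only [Bool.not_eq_false, Bool.and_eq_true] at h
      simp [ht x y z h.1.1 h.1.2] at h
    simp [hasTriangle, ht']
  rw [sum_pattern_certificate₅ he, sum_pattern_certificate₄ he, sum_pattern_certificate₃ he,
    sum_pattern_certificate₂ he] at h
  linarith

/-- For a fixed root triple the sum over the last two vertices factors as a weight times a perfect
square. The next lemma does the same for a single root and two disjoint pairs. -/
theorem sum_mul_self_form_nonneg (w : V → V → V → ℤ) (hw : ∀ a b c, 0 ≤ w a b c)
    (q : V → V → V → V → ℤ) :
    0 ≤ ∑ a, ∑ b, ∑ c, ∑ d, ∑ x, w a b c * (q a b c d * q a b c x) := by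
  refine Finset.sum_nonneg fun a _ => Finset.sum_nonneg fun b _ => Finset.sum_nonneg fun c _ => ?_
  simp only [← Finset.mul_sum, ← Finset.sum_mul]
  exact mul_nonneg (hw a b c) (mul_self_nonneg _)

theorem sum_mul_self_pairForm_nonneg {w : ℤ} (hw : 0 ≤ w) (q : V → V → V → ℤ) :
    0 ≤ ∑ a, ∑ b, ∑ c, ∑ d, ∑ x, w * (q a b c * q a d x) := by
  refine Finset.sum_nonneg fun a _ => ?_
  simp only [← Finset.mul_sum, ← Finset.sum_mul]
  exact mul_nonneg hw (mul_self_nonneg _)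

theorem cond_nonneg {b : Bool} {x y : ℤ} (hx : 0 ≤ x) (hy : 0 ≤ y) : 0 ≤ bif b then x else y := by
  cases b <;> assumption

theorem sum_squarePart_nonneg (e : V → V → Bool) : 0 ≤ ∑ f, pattern e squarePart f := by
  refine (?_ : (0 : ℤ) ≤ _).trans_eq
    (sum_fin_five_arrow fun a b c d x => squarePart (e a b) (e a c) (e a d) (e a x) (e b c)
    (e b d) (e b x) (e c d) (e c x) (e d x)).symm
  simp only [squarePart, Finset.sum_add_distrib]
  refine add_nonneg (add_nonneg (add_nonneg (add_nonneg (add_nonneg (add_nonneg (add_nonneg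
    ?_ ?_) ?_) ?_) ?_) ?_) ?_) ?_
  · exact sum_mul_self_pairForm_nonneg (by norm_num)
      fun a b c => pairForm 0 2 (-1) 1 (-2) (e b c) (e a b) (e a c)
  · exact sum_mul_self_pairForm_nonneg (by norm_num)
      fun a b c => pairForm 2 1 (-2) 0 (-2) (e b c) (e a b) (e a c)
  · exact sum_mul_self_pairForm_nonneg (by norm_num)
      fun a b c => pairForm 2 1 (-1) 0 (-3) (e b c) (e a b) (e a c)
  · exact sum_mul_self_pairForm_nonneg (by norm_num)
      fun a b c => pairForm 2 3 (-2) 0 (-3) (e b c) (e a b) (e a c)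
  · exact sum_mul_self_form_nonneg (fun a b c => bif e a b && !e a c && !e b c then _ else 0)
      (fun a b c => cond_nonneg (by norm_num) le_rfl)
      fun a b c d => edgeForm 0 1 (-1) 0 1 (-1) (e a d) (e b d) (e c d)
  · exact sum_mul_self_form_nonneg (fun a b c => bif e a b && !e a c && !e b c then _ else 0)
      (fun a b c => cond_nonneg (by norm_num) le_rfl)
      fun a b c d => edgeForm 6 0 0 1 (-3) (-3) (e a d) (e b d) (e c d)
  · exact sum_mul_self_form_nonneg (fun a b c => bif e a b || e a c || e b c then 0 else _)
      (fun a b c => cond_nonneg le_rfl (by norm_num))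
      fun a b c d => indepForm 2 4 (-5) (-3) (e a d) (e b d) (e c d)
  · exact sum_mul_self_form_nonneg (fun a b c => bif e a b || e a c || e b c then 0 else _)
      (fun a b c => cond_nonneg le_rfl (by norm_num))
      fun a b c d => indepForm 4 3 (-5) (-6) (e a d) (e b d) (e c d)

/-- The indicator of an independent quadruple (repetitions allowed). -/
def indepInd (e : V → V → Bool) (a b c d : V) : ℤ :=
  bif e a b || e a c || e b c || e a d || e b d || e c d then 0 else 1

/-- The indicator of an induced path `abcd` with a vertex `x` adjacent to none of `a, b, c`. -/
def defectInd (e : V → V → Bool) (a b c d x : V) : ℤ :=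
  bif pathDefect (e a b) (e a c) (e a d) (e a x) (e b c) (e b d) (e b x) (e c d) (e c x)
    then 1 else 0

/-- `5 deg a - 2 n`, a measure of the deviation of the degree of `a` from `2n / 5`. -/
def degDev (e : V → V → Bool) (a : V) : ℤ := ∑ b, bif e a b then 3 else -2

/-- Sum the certificate, discard the squares in `squarePart` and divide by 63420, noting 1585500 =
25 · 63420. Every discarded form averages to zero on the balanced blow-up of C₅, so nothing is lost
to leading order. The degree term is one more square, kept on the left for stability. -/
theorem indep_quadruple_bound (he : ∀ x y, e x y = e y x)
    (ht : ∀ x y z, e x y = true → e x z = true → e y z = false) :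
    (Fintype.card V : ℤ) ^ 2 * ∑ a, degDev e a ^ 2 +
      25 * ∑ a, ∑ b, ∑ c, ∑ d, ∑ x, defectInd e a b c d x ≤
    25 * (25 * Fintype.card V * (∑ a, ∑ b, ∑ c, ∑ d, indepInd e a b c d)
      - 3 * (Fintype.card V : ℤ) ^ 5) := by
  have h := sum_pattern_certificate_nonneg he ht
  have h₂ := sum_squarePart_nonneg e
  have h₃ : ∑ f, pattern e certificate f + ∑ f, pattern e squarePart f =
      ∑ a, ∑ b, ∑ c, ∑ d, ∑ x, (1585500 * (25 * indepInd e a b c d - 3 - defectInd e a b c d x)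
        - 63420 * ((bif e a b then 3 else -2) * (bif e a c then 3 else -2))) := by
    rw [← Finset.sum_add_distrib, ← sum_fin_five_arrow]
    refine Finset.sum_congr rfl fun f _ => ?_
    simp only [pattern, certificate, indepInd, defectInd]
    ring
  have h₄ : ∑ a, ∑ b, ∑ c, ∑ _d : V, ∑ _x : V,
      (63420 * ((bif e a b then 3 else -2) * (bif e a c then 3 else -2)) : ℤ) =
      63420 * ((Fintype.card V : ℤ) ^ 2 * ∑ a, degDev e a ^ 2) := by
    simp only [Finset.sum_const, Finset.card_univ, nsmul_eq_mul, degDev, ← Finset.mul_sum,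
      ← Finset.sum_mul]
    ring_nf
  simp only [Finset.sum_sub_distrib] at h₃
  rw [h₄] at h₃
  simp only [← Finset.mul_sum, Finset.sum_sub_distrib, Finset.sum_const, Finset.card_univ,
    nsmul_eq_mul] at h₃
  linarith

end Patterns

/-! ### The number of induced paths on four vertices -/

/-- A combination of subgraph counts which vanishes on triangle-free patterns after
symmetrization. -/
def pathIdentity (b01 b02 b03 b12 b13 b23 : Bool) : ℤ :=
  3 * (bif b01 && b12 && b23 && !b02 && !b03 && !b13 then 1 else 0) +
  (bif b01 || b02 || b12 || b03 || b13 || b23 then 0 else 1) - 1 + 6 * b01.toNat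
  - 12 * (b01.toNat * b02.toNat) - 3 * (b01.toNat * b23.toNat)
  + 4 * (b01.toNat * b02.toNat * b03.toNat) + 9 * (b01.toNat * b12.toNat * b23.toNat)

/-- The path identity symmetrized over the first two vertices. -/
def pathIdentity₂ (b01 b02 b03 b12 b13 b23 : Bool) : ℤ :=
  pathIdentity b01 b02 b03 b12 b13 b23 +
  pathIdentity b01 b12 b13 b02 b03 b23

/-- The path identity symmetrized over the first three vertices. -/
def pathIdentity₃ (b01 b02 b03 b12 b13 b23 : Bool) : ℤ :=
  pathIdentity₂ b01 b02 b03 b12 b13 b23 +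
  pathIdentity₂ b12 b02 b23 b01 b13 b03 +
  pathIdentity₂ b02 b01 b03 b12 b23 b13

/-- The path identity symmetrized over the first four vertices. -/
def pathIdentity₄ (b01 b02 b03 b12 b13 b23 : Bool) : ℤ :=
  pathIdentity₃ b01 b02 b03 b12 b13 b23 +
  pathIdentity₃ b13 b23 b03 b12 b01 b02 +
  pathIdentity₃ b03 b02 b01 b23 b13 b12 +
  pathIdentity₃ b01 b03 b02 b13 b12 b23

/-- Inclusion–exclusion: without triangles, the indicator of an independent quadruple expands into
edges, cherries, matchings, stars, paths and four-cycles. An induced path is a path minus a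
four-cycle, so the coefficient 3 cancels the four-cycles and leaves only terms computable from
degrees and edges. -/
theorem pathIdentity₄_eq_zero : ∀ b01 b02 b03 b12 b13 b23 : Bool,
    ((b01 && b02 && b12) || (b01 && b03 && b13) || (b02 && b03 && b23) || (b12 && b13 && b23)) =
      false → pathIdentity₄ b01 b02 b03 b12 b13 b23 = 0 := by
  decide +kernel

section Patterns

variable {V : Type*} [Fintype V]

/-- The pattern which `e` induces on four vertices. -/
def pattern₄ (e : V → V → Bool) {α : Type*} (A : Bool → Bool → Bool → Bool → Bool → Bool → α)
    (f : Fin 4 → V) : α :=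
  A (e (f 0) (f 1)) (e (f 0) (f 2)) (e (f 0) (f 3)) (e (f 1) (f 2)) (e (f 1) (f 3))
    (e (f 2) (f 3))

variable {e : V → V → Bool}

theorem sum_pattern_pathIdentity₂ (he : ∀ x y, e x y = e y x) :
    ∑ f, pattern₄ e pathIdentity₂ f = 2 * ∑ f, pattern₄ e pathIdentity f := by
  have key : ∀ f, pattern₄ e pathIdentity₂ f = pattern₄ e pathIdentity f
      + pattern₄ e pathIdentity (f ∘ Equiv.swap 0 1) := by
    intro f
    simp only [pattern₄, pathIdentity₂, Function.comp_apply, Equiv.swap_apply_def, Fin.reduceEq,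
      if_true, if_false, he (f 1) (f 0)]
  simp only [key, Finset.sum_add_distrib, sum_comp_swap]
  ring

theorem sum_pattern_pathIdentity₃ (he : ∀ x y, e x y = e y x) :
    ∑ f, pattern₄ e pathIdentity₃ f = 3 * ∑ f, pattern₄ e pathIdentity₂ f := by
  have key : ∀ f, pattern₄ e pathIdentity₃ f = pattern₄ e pathIdentity₂ f
      + pattern₄ e pathIdentity₂ (f ∘ Equiv.swap 0 2)
      + pattern₄ e pathIdentity₂ (f ∘ Equiv.swap 1 2) := by
    intro f
    simp only [pattern₄, pathIdentity₃, Function.comp_apply, Equiv.swap_apply_def, Fin.reduceEq,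
      if_true, if_false, he (f 1) (f 0), he (f 2) (f 0), he (f 2) (f 1)]
  simp only [key, Finset.sum_add_distrib, sum_comp_swap]
  ring

theorem sum_pattern_pathIdentity₄ (he : ∀ x y, e x y = e y x) :
    ∑ f, pattern₄ e pathIdentity₄ f = 4 * ∑ f, pattern₄ e pathIdentity₃ f := by
  have key : ∀ f, pattern₄ e pathIdentity₄ f = pattern₄ e pathIdentity₃ f
      + pattern₄ e pathIdentity₃ (f ∘ Equiv.swap 0 3)
      + pattern₄ e pathIdentity₃ (f ∘ Equiv.swap 1 3)
      + pattern₄ e pathIdentity₃ (f ∘ Equiv.swap 2 3) := by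
    intro f
    simp only [pattern₄, pathIdentity₄, Function.comp_apply, Equiv.swap_apply_def, Fin.reduceEq,
      if_true, if_false, he (f 1) (f 0), he (f 2) (f 0), he (f 3) (f 0), he (f 2) (f 1), he (f 3) (f 1),
      he (f 3) (f 2)]
  simp only [key, Finset.sum_add_distrib, sum_comp_swap]
  ring

theorem sum_pattern_pathIdentity (he : ∀ x y, e x y = e y x)
    (ht : ∀ x y z, e x y = true → e x z = true → e y z = false) :
    ∑ f, pattern₄ e pathIdentity f = 0 := by
  have h : ∑ f, pattern₄ e pathIdentity₄ f = 0 := by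
    refine Finset.sum_eq_zero fun f _ => pathIdentity₄_eq_zero _ _ _ _ _ _ ?_
    have ht' : ∀ x y z, (e x y && e x z && e y z) = false := by
      intro x y z
      by_contra h
      simp only [Bool.not_eq_false, Bool.and_eq_true] at h
      simp [ht x y z h.1.1 h.1.2] at h
    simp [ht']
  rw [sum_pattern_pathIdentity₄ he, sum_pattern_pathIdentity₃ he,
    sum_pattern_pathIdentity₂ he] at h
  linarith

/-- The indicator of an induced path `abcd`. -/
def pathInd (e : V → V → Bool) (a b c d : V) : ℤ :=
  bif e a b && e b c && e c d && !e a c && !e a d && !e b d then 1 else 0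

theorem five_mul_sum_toNat (e : V → V → Bool) (a : V) :
    (5 * ∑ b, ((e a b).toNat : ℤ)) = 2 * Fintype.card V + degDev e a := by
  have : ∀ b : Bool, (bif b then 3 else -2 : ℤ) = 5 * b.toNat - 2 := by decide
  simp only [degDev, this, Finset.sum_sub_distrib, Finset.sum_const, Finset.card_univ,
    nsmul_eq_mul, ← Finset.mul_sum]
  ring

theorem degDev_le (e : V → V → Bool) (a : V) : degDev e a ≤ 3 * Fintype.card V := by
  have : ∀ b : Bool, (bif b then 3 else -2 : ℤ) ≤ 3 := by decide
  refine (Finset.sum_le_sum fun b _ => this (e a b)).trans_eq ?_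
  simp [mul_comm]

/-- When T is near 3n⁴/25 and the degrees are near 2n/5, this forces about 2n⁴/125 induced paths,
the value in the balanced blow-up. It comes from the path identity with each degree written as `(2n
+ x) / 5`, where x is its `degDev`. -/
theorem path_quadruple_bound (he : ∀ x y, e x y = e y x)
    (ht : ∀ x y z, e x y = true → e x z = true → e y z = false) :
    168 * (Fintype.card V : ℤ) ^ 4 ≤ 3000 * (∑ a, ∑ b, ∑ c, ∑ d, pathInd e a b c d) +
      1000 * (∑ a, ∑ b, ∑ c, ∑ d, indepInd e a b c d) +
      48 * (Fintype.card V : ℤ) ^ 2 * (∑ a, degDev e a) +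
      456 * Fintype.card V * ∑ a, degDev e a ^ 2 := by
  set n : ℤ := ((Fintype.card V : ℕ) : ℤ) with hn
  set E : V → V → ℤ := fun a b => (e a b).toNat with hE
  set g : V → ℤ := fun a => ∑ b, E a b with hg
  set x : V → ℤ := degDev e with hx
  have hgx : ∀ a, 5 * g a = 2 * n + x a := five_mul_sum_toNat e
  have hxn : ∀ a, x a ≤ 3 * n := degDev_le e
  have hEs : ∀ a b, E a b = E b a := fun a b => by simp only [hE, he a b]
  have h := sum_pattern_pathIdentity he ht
  have h₁ : ∑ f, pattern₄ e pathIdentity f = ∑ a, ∑ b, ∑ c, ∑ d,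
      (3 * pathInd e a b c d + indepInd e a b c d - 1 + 6 * E a b - 12 * (E a b * E a c)
        - 3 * (E a b * E c d) + 4 * (E a b * E a c * E a d) + 9 * (E a b * E b c * E c d)) :=
    sum_fin_four_arrow fun a b c d => pathIdentity (e a b) (e a c) (e a d) (e b c) (e b d) (e c d)
  have e₀ : ∑ _a : V, ∑ _b : V, ∑ _c : V, ∑ _d : V, (1 : ℤ) = n ^ 4 := by
    simp [← hn]
    ring
  have e₁ : ∑ a, ∑ b, ∑ c, ∑ d, 9 * (E a b * E b c * E c d) =
      9 * ∑ b, ∑ c, E b c * (g b * g c) := by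
    simp only [mul_assoc, ← Finset.mul_sum]
    rw [Finset.sum_comm]
    congr 1
    refine Finset.sum_congr rfl fun b _ => ?_
    rw [← Finset.sum_mul, Finset.mul_sum]
    refine Finset.sum_congr rfl fun c _ => ?_
    simp only [hg, hEs b]
    ring
  have e₂ : ∑ a, ∑ b, ∑ _c : V, ∑ _d : V, 6 * E a b = 6 * n ^ 2 * ∑ a, g a := by
    simp only [Finset.sum_const, Finset.card_univ, nsmul_eq_mul, ← Finset.mul_sum, ← hn, hg]
    ring
  have e₃ : ∑ a, ∑ b, ∑ c, ∑ _d : V, 12 * (E a b * E a c) = 12 * n * ∑ a, g a ^ 2 := by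
    simp only [Finset.sum_const, Finset.card_univ, nsmul_eq_mul, ← Finset.mul_sum,
      ← Finset.sum_mul, ← hn, hg, pow_two]
    ring
  have e₄ : ∑ a, ∑ b, ∑ c, ∑ d, 3 * (E a b * E c d) = 3 * (∑ a, g a) ^ 2 := by
    simp only [← Finset.mul_sum, ← Finset.sum_mul, hg, pow_two]
  have e₅ : ∑ a, ∑ b, ∑ c, ∑ d, 4 * (E a b * E a c * E a d) = 4 * ∑ a, g a ^ 3 := by
    simp only [← Finset.mul_sum, ← Finset.sum_mul, hg, pow_succ, pow_zero, one_mul]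
  rw [h₁] at h
  simp only [Finset.sum_add_distrib, Finset.sum_sub_distrib, e₀, e₁, e₂, e₃, e₄, e₅] at h
  simp only [← Finset.mul_sum] at h
  have s₁ : 5 * ∑ a, g a = 2 * n ^ 2 + ∑ a, x a := by
    simp only [Finset.mul_sum, hgx, Finset.sum_add_distrib, Finset.sum_const, Finset.card_univ,
      nsmul_eq_mul, ← hn]
    ring
  have s₂ : 25 * ∑ a, g a ^ 2 = 4 * n ^ 3 + 4 * n * (∑ a, x a) + ∑ a, x a ^ 2 := by
    have : ∀ a, 25 * g a ^ 2 = 4 * n ^ 2 + 4 * n * x a + x a ^ 2 := fun a => by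
      linear_combination (5 * g a + 2 * n + x a) * hgx a
    simp only [Finset.mul_sum, this, Finset.sum_add_distrib, Finset.sum_const, Finset.card_univ,
      nsmul_eq_mul, ← hn]
    ring
  -- The cubic term is absorbed by x³ ≤ 3n x², as x ≤ 3n.
  have s₃ : 125 * ∑ a, g a ^ 3 ≤ 8 * n ^ 4 + 12 * n ^ 2 * (∑ a, x a) + 9 * n * ∑ a, x a ^ 2 := by
    have : ∀ a, 125 * g a ^ 3 ≤ 8 * n ^ 3 + 12 * n ^ 2 * x a + 9 * n * x a ^ 2 := fun a => by
      have h₁ : 125 * g a ^ 3 = (2 * n + x a) ^ 3 := by rw [← hgx]; ring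
      nlinarith [mul_nonneg (sub_nonneg.2 (hxn a)) (sq_nonneg (x a))]
    rw [Finset.mul_sum]
    refine (Finset.sum_le_sum fun a _ => this a).trans_eq ?_
    simp only [Finset.sum_add_distrib, Finset.sum_const, Finset.card_univ, nsmul_eq_mul, ← hn,
      ← Finset.mul_sum]
    ring
  have s₄ : 125 * ∑ b, ∑ c, E b c * (g b * g c) ≤
      8 * n ^ 4 + 12 * n ^ 2 * (∑ a, x a) + 9 * n * ∑ a, x a ^ 2 := by
    -- On an edge, 2 x_b x_c ≤ x_b² + x_c²; on a non-edge the left side is 0. Thus only degree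
    -- statistics survive.
    have key : ∀ b c, 50 * (E b c * (g b * g c)) ≤ 8 * n ^ 2 * E b c + 4 * n * (E b c * x b)
        + 4 * n * (E c b * x c) + x b ^ 2 + x c ^ 2 := fun b c => by
      have h₁ : 25 * (g b * g c) = (2 * n + x b) * (2 * n + x c) := by
        rw [← hgx, ← hgx]
        ring
      have h₂ : E b c = 0 ∨ E b c = 1 := by
        simp only [hE]
        cases e b c <;> simp
      rcases h₂ with h₂ | h₂ <;> rw [← hEs b c, h₂] <;>
        nlinarith [sq_nonneg (x b - x c), sq_nonneg (x b), sq_nonneg (x c)]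
    have h₂ := Finset.sum_le_sum fun b (_ : b ∈ Finset.univ) =>
      Finset.sum_le_sum fun c (_ : c ∈ Finset.univ) => key b c
    have h₃ : ∑ b, ∑ c, E b c * x b = ∑ b, g b * x b := by simp only [← Finset.sum_mul, hg]
    have h₄ : ∑ b, ∑ c, E c b * x c = ∑ b, g b * x b := by rw [Finset.sum_comm, h₃]
    have h₅ : 5 * ∑ b, g b * x b = 2 * n * (∑ a, x a) + ∑ a, x a ^ 2 := by
      simp only [Finset.mul_sum, ← mul_assoc, hgx, ← Finset.sum_add_distrib]
      refine Finset.sum_congr rfl fun a _ => by ring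
    have h₆ : ∑ b, ∑ c, E b c = ∑ b, g b := rfl
    simp only [Finset.sum_add_distrib, ← Finset.mul_sum, Finset.sum_const, Finset.card_univ,
      nsmul_eq_mul, ← hn, h₃, h₄, h₆] at h₂
    nlinarith
  nlinarith [sq_nonneg (∑ a, x a), congrArg (fun t => t ^ 2) s₁, congrArg (fun t => n ^ 2 * t) s₁,
    congrArg (fun t => n * t) s₂]

end Patterns

/-! ### Finding an induced path all of whose statistics are typical -/

theorem defectInd_nonneg {V : Type*} (e : V → V → Bool) (a b c d x : V) :
    0 ≤ defectInd e a b c d x :=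
  cond_nonneg zero_le_one le_rfl

section Patterns

variable {V : Type*} [Fintype V] {e : V → V → Bool}

theorem sum_comp_of_injective {M : Type*} [AddCommMonoid M] {n : ℕ} (F : (Fin n → V) → M)
    {σ : Fin n → Fin n} (hσ : σ.Injective) : ∑ f, F (f ∘ σ) = ∑ f, F f :=
  ((Equiv.ofBijective σ hσ.bijective_of_finite).symm.arrowCongr (Equiv.refl V)).sum_comp F

/-- A weighted sum of the statistics of an induced path `abcd` that are small in near-extremal
graphs: the degree deviations, the numbers of vertices with an irregular neighbourhood on the
path, and the numbers of missing edges between the classes defined by the path. -/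
def pathStat (e : V → V → Bool) (a b c d : V) : ℤ :=
  Fintype.card V * (degDev e a ^ 2 + degDev e b ^ 2 + degDev e c ^ 2 + degDev e d ^ 2) +
  (Fintype.card V : ℤ) ^ 2 * (∑ x, defectInd e a b c d x + ∑ x, defectInd e d c b a x) +
  Fintype.card V * (∑ x, ∑ y, defectInd e x b a y d + ∑ x, ∑ y, defectInd e a x c d y +
    ∑ x, ∑ y, defectInd e x c d y a)

theorem pathStat_nonneg (e : V → V → Bool) (a b c d : V) : 0 ≤ pathStat e a b c d := by
  have := defectInd_nonneg e
  unfold pathStat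
  have h₁ : ∀ a b c d : V, 0 ≤ ∑ x, defectInd e a b c d x := fun a b c d =>
    Finset.sum_nonneg fun x _ => this _ _ _ _ _
  have h₂ : 0 ≤ ∑ x, ∑ y, defectInd e x b a y d :=
    Finset.sum_nonneg fun x _ => Finset.sum_nonneg fun y _ => this _ _ _ _ _
  have h₃ : 0 ≤ ∑ x, ∑ y, defectInd e a x c d y :=
    Finset.sum_nonneg fun x _ => Finset.sum_nonneg fun y _ => this _ _ _ _ _
  have h₄ : 0 ≤ ∑ x, ∑ y, defectInd e x c d y a :=
    Finset.sum_nonneg fun x _ => Finset.sum_nonneg fun y _ => this _ _ _ _ _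
  exact add_nonneg (add_nonneg (mul_nonneg (Int.natCast_nonneg _)
    (add_nonneg (add_nonneg (add_nonneg (sq_nonneg _) (sq_nonneg _)) (sq_nonneg _)) (sq_nonneg _)))
    (mul_nonneg (sq_nonneg _) (add_nonneg (h₁ a b c d) (h₁ d c b a))))
    (mul_nonneg (Int.natCast_nonneg _) (add_nonneg (add_nonneg h₂ h₃) h₄))

/-- Each defect sum in `pathStat` is the same five-fold sum with its labels permuted; the powers of
n there compensate for the number of free vertices. -/
theorem sum_pathStat (e : V → V → Bool) :
    ∑ a, ∑ b, ∑ c, ∑ d, pathStat e a b c d =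
      4 * (Fintype.card V : ℤ) ^ 4 * ∑ a, degDev e a ^ 2 +
      5 * (Fintype.card V : ℤ) ^ 2 * ∑ a, ∑ b, ∑ c, ∑ d, ∑ x, defectInd e a b c d x := by
  have h₁ : ∑ a, ∑ b, ∑ c, ∑ d, ∑ x, defectInd e d c b a x =
      ∑ a, ∑ b, ∑ c, ∑ d, ∑ x, defectInd e a b c d x := by
    rw [← sum_fin_five_arrow fun a b c d x => defectInd e d c b a x,
      ← sum_fin_five_arrow (defectInd e)]
    exact sum_comp_of_injective (fun f : Fin 5 → V => defectInd e (f 0) (f 1) (f 2) (f 3) (f 4))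
      (σ := ![3, 2, 1, 0, 4]) (by decide)
  have h₂ : ∑ a, ∑ b, ∑ d, ∑ x, ∑ y, defectInd e x b a y d =
      ∑ a, ∑ b, ∑ c, ∑ d, ∑ x, defectInd e a b c d x := by
    rw [← sum_fin_five_arrow fun a b d x y => defectInd e x b a y d,
      ← sum_fin_five_arrow (defectInd e)]
    exact sum_comp_of_injective (fun f : Fin 5 → V => defectInd e (f 0) (f 1) (f 2) (f 3) (f 4))
      (σ := ![3, 1, 0, 4, 2]) (by decide)
  have h₃ : ∑ a, ∑ c, ∑ d, ∑ x, ∑ y, defectInd e a x c d y =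
      ∑ a, ∑ b, ∑ c, ∑ d, ∑ x, defectInd e a b c d x := by
    rw [← sum_fin_five_arrow fun a c d x y => defectInd e a x c d y,
      ← sum_fin_five_arrow (defectInd e)]
    exact sum_comp_of_injective (fun f : Fin 5 → V => defectInd e (f 0) (f 1) (f 2) (f 3) (f 4))
      (σ := ![0, 3, 1, 2, 4]) (by decide)
  have h₄ : ∑ a, ∑ c, ∑ d, ∑ x, ∑ y, defectInd e x c d y a =
      ∑ a, ∑ b, ∑ c, ∑ d, ∑ x, defectInd e a b c d x := by
    rw [← sum_fin_five_arrow fun a c d x y => defectInd e x c d y a,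
      ← sum_fin_five_arrow (defectInd e)]
    exact sum_comp_of_injective (fun f : Fin 5 → V => defectInd e (f 0) (f 1) (f 2) (f 3) (f 4))
      (σ := ![3, 1, 2, 4, 0]) (by decide)
  simp only [pathStat, Finset.sum_add_distrib, ← Finset.mul_sum, h₁, h₂, h₃, h₄, Finset.sum_const,
    Finset.card_univ, nsmul_eq_mul]
  ring

/-- Averaging over induced paths. The slack is at most 25Kn⁴, so the total of `pathStat` is at most
(4 · 25 + 5)Kn⁶, while there are at least n⁴/250 induced paths; 26250 = 250 · 105. -/
theorem exists_typical_path {K : ℤ} (hK : 1 ≤ K) (he : ∀ x y, e x y = e y x)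
    (ht : ∀ x y z, e x y = true → e x z = true → e y z = false)
    (hn : 1000 * K ≤ Fintype.card V)
    (hT : 25 * ∑ a, ∑ b, ∑ c, ∑ d, indepInd e a b c d ≤
      3 * (Fintype.card V : ℤ) ^ 4 + K * (Fintype.card V : ℤ) ^ 3) :
    ∃ a b c d, pathInd e a b c d = 1 ∧
      pathStat e a b c d ≤ 26250 * K * (Fintype.card V : ℤ) ^ 2 := by
  have hA := indep_quadruple_bound he ht
  have hP := path_quadruple_bound he ht
  have hS := sum_pathStat e
  have hS₁ : (∑ a, degDev e a) ^ 2 ≤ Fintype.card V * ∑ a, degDev e a ^ 2 := by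
    have := sq_sum_le_card_mul_sum_sq (s := Finset.univ) (f := degDev e)
    simpa using this
  have hB₀ : 0 ≤ ∑ a, ∑ b, ∑ c, ∑ d, ∑ x, defectInd e a b c d x :=
    Finset.sum_nonneg fun a _ => Finset.sum_nonneg fun b _ => Finset.sum_nonneg fun c _ =>
      Finset.sum_nonneg fun d _ => Finset.sum_nonneg fun x _ => defectInd_nonneg e a b c d x
  have hS₂₀ : 0 ≤ ∑ a, degDev e a ^ 2 := Finset.sum_nonneg fun a _ => sq_nonneg _
  by_contra! hcon
  have hsum : (∑ a, ∑ b, ∑ c, ∑ d, pathInd e a b c d) *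
      (26250 * K * (Fintype.card V : ℤ) ^ 2 + 1) ≤ ∑ a, ∑ b, ∑ c, ∑ d, pathStat e a b c d := by
    simp only [Finset.sum_mul]
    refine Finset.sum_le_sum fun a _ => Finset.sum_le_sum fun b _ => Finset.sum_le_sum fun c _ =>
      Finset.sum_le_sum fun d _ => ?_
    have h₀ : pathInd e a b c d = 0 ∨ pathInd e a b c d = 1 := by
      unfold pathInd
      generalize (e a b && e b c && e c d && !e a c && !e a d && !e b d) = t
      cases t <;> simp
    rcases h₀ with h₀ | h₀
    · rw [h₀, zero_mul]
      exact pathStat_nonneg e a b c d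
    · rw [h₀, one_mul]
      exact hcon a b c d h₀
  rw [hS] at hsum
  clear hcon hS
  generalize (∑ a, ∑ b, ∑ c, ∑ d, pathInd e a b c d) = P at *
  generalize (∑ a, ∑ b, ∑ c, ∑ d, indepInd e a b c d) = T at *
  generalize (∑ a, ∑ b, ∑ c, ∑ d, ∑ x, defectInd e a b c d x) = B at *
  generalize (∑ a, degDev e a) = S₁ at *
  generalize (∑ a, degDev e a ^ 2) = S₂ at *
  generalize (Fintype.card V : ℤ) = n at *
  have hn0 : 0 < n := by linarith
  have hAK : n ^ 2 * S₂ + 25 * B ≤ 25 * K * n ^ 4 := by nlinarith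
  have hS₂ : S₂ ≤ 25 * K * n ^ 2 := by
    have : n ^ 2 * S₂ ≤ n ^ 2 * (25 * K * n ^ 2) := by nlinarith
    exact le_of_mul_le_mul_left this (by positivity)
  have hB : B ≤ K * n ^ 4 := by nlinarith [mul_nonneg (sq_nonneg n) hS₂₀]
  have hn3 : 1000 * K * n ^ 3 ≤ n ^ 4 := by nlinarith [pow_pos hn0 3]
  have hS₁' : 2 * S₁ ≤ n ^ 2 := by
    refine (le_abs_self _).trans (abs_le_of_sq_le_sq ?_ (by positivity))
    nlinarith
  have hP' : n ^ 4 ≤ 250 * P := by nlinarith [sq_nonneg n]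
  nlinarith [pow_pos hn0 4, pow_pos hn0 6, pow_pos hn0 2, mul_pos (pow_pos hn0 2)
    (by linarith : 0 < K)]

end Patterns

/-! ### The approximate blow-up structure -/

section Patterns

variable {V : Type*} [Fintype V] {e : V → V → Bool}

open Finset in
/-- The sets `S i` form, up to an error `η`, a balanced blow-up of the five-cycle in `e`. -/
structure NearBlowUp (e : V → V → Bool) (η : ℝ) (S : Fin 5 → Finset V) : Prop where
  card_sub_le : ∀ i, |(#(S i) : ℝ) - Fintype.card V / 5| ≤ η * Fintype.card V
  eq_of_mem : ∀ i j x, x ∈ S i → x ∈ S j → i = j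
  nonadj : ∀ i j, j ≠ i + 1 → i ≠ j + 1 → ∀ x ∈ S i, ∀ y ∈ S j, e x y = false
  card_missing_le : ∀ i, (#{p ∈ S i ×ˢ S (i + 1) | e p.1 p.2 = false} : ℝ) ≤
    η * (Fintype.card V : ℝ) ^ 2

theorem defectInd_eq_one {V : Type*} {e : V → V → Bool} {a b c d x : V} (h₁ : e a b = true)
    (h₂ : e b c = true) (h₃ : e c d = true) (h₄ : e a c = false) (h₅ : e a d = false)
    (h₆ : e b d = false) (h₇ : e a x = false) (h₈ : e b x = false) (h₉ : e c x = false) :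
    defectInd e a b c d x = 1 := by
  simp [defectInd, pathDefect, *]

open Finset in
theorem card_missing_le_sum {D : V → V → ℤ} (hD : ∀ x y, 0 ≤ D x y) {A B : Finset V}
    (h : ∀ x ∈ A, ∀ y ∈ B, e x y = false → D x y = 1) :
    (#{p ∈ A ×ˢ B | e p.1 p.2 = false} : ℤ) ≤ ∑ x, ∑ y, D x y := by
  rw [← Fintype.sum_prod_type', Finset.card_eq_sum_ones]
  push_cast
  refine (Finset.sum_le_sum (g := fun p : V × V => D p.1 p.2) fun p hp => ?_).trans
    (Finset.sum_le_univ_sum_of_nonneg fun p => hD p.1 p.2)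
  simp only [mem_filter, mem_product] at hp
  exact (h p.1 hp.1.1 p.2 hp.1.2 hp.2).ge

open Finset in
theorem card_le_sum_of_eq_one {D : V → ℤ} (hD : ∀ x, 0 ≤ D x) {A : Finset V}
    (h : ∀ x ∈ A, D x = 1) : (#A : ℤ) ≤ ∑ x, D x := by
  rw [Finset.card_eq_sum_ones]
  push_cast
  exact (Finset.sum_le_sum fun p hp => (h p hp).ge).trans
    (Finset.sum_le_univ_sum_of_nonneg fun p => hD p)

open Finset in
theorem five_mul_card_neighbors (e : V → V → Bool) (a : V) :
    5 * (#{x | e a x = true} : ℤ) = 2 * Fintype.card V + degDev e a := by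
  rw [← five_mul_sum_toNat, Finset.card_filter]
  push_cast
  congr 1
  refine Finset.sum_congr rfl fun x _ => ?_
  cases e a x <;> rfl

open Finset in
theorem card_filter_and_add (p q : V → Bool) :
    #{x | p x = true ∧ q x = true} + #{x | p x = true ∧ q x = false} = #{x | p x = true} := by
  rw [← Finset.card_filter_add_card_filter_not (s := {x | p x = true}) (fun x => q x = true),
    Finset.filter_filter, Finset.filter_filter]
  simp

open Finset in
/-- There is a vertex of `C` which is adjacent to almost all of `A` and `B`. -/
theorem exists_mem_card_nonadj_le {V : Type*} {e : V → V → Bool}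
    {A B C : Finset V} {M m : ℝ} (hm : 0 < m) (hC : m ≤ #C)
    (hA : (#{p ∈ C ×ˢ A | e p.1 p.2 = false} : ℝ) ≤ M)
    (hB : (#{p ∈ C ×ˢ B | e p.1 p.2 = false} : ℝ) ≤ M) :
    ∃ w ∈ C, (#{x ∈ A | e w x = false} : ℝ) + #{x ∈ B | e w x = false} ≤ 2 * M / m := by
  by_contra! hcon
  have hs : ∀ D : Finset V, (#{p ∈ C ×ˢ D | e p.1 p.2 = false} : ℝ) =
      ∑ w ∈ C, (#{x ∈ D | e w x = false} : ℝ) := by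
    intro D
    simp only [Finset.card_filter, Finset.sum_product]
    push_cast
    rfl
  have hne : C.Nonempty := by
    rw [← Finset.card_pos]
    exact_mod_cast hm.trans_le hC
  have h := Finset.sum_lt_sum_of_nonempty hne hcon
  rw [Finset.sum_add_distrib, ← hs, ← hs, Finset.sum_const, nsmul_eq_mul] at h
  have h₂ : 0 ≤ 2 * M / m := by
    have : 0 ≤ M := le_trans (by positivity) hA
    positivity
  have h₃ : m * (2 * M / m) ≤ #C * (2 * M / m) := mul_le_mul_of_nonneg_right hC h₂
  rw [mul_div_cancel₀ _ hm.ne'] at h₃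
  linarith

set_option maxHeartbeats 2000000 in
open Finset in
-- The path plays consecutive vertices of C₅, with a, b, c, d in classes 1 to 4, and each class is
-- read off from adjacency to the path. Small degree deviations fix the class sizes. Unclassified
-- vertices and missing edges between consecutive classes are both counted by defects.
theorem exists_nearBlowUp_of_path {η : ℝ} (hη : η ≤ 1 / 1000) (hη₀ : 0 < η)
    (he : ∀ x y, e x y = e y x)
    (ht : ∀ x y z, e x y = true → e x z = true → e y z = false) {a b c d : V}
    (hV : 0 < Fintype.card V)
    (hp : pathInd e a b c d = 1)
    (hdev : ∀ x, x = a ∨ x = b ∨ x = c ∨ x = d → |(degDev e x : ℝ)| ≤ η * Fintype.card V)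
    (hX : ((∑ x, defectInd e a b c d x + ∑ x, defectInd e d c b a x : ℤ) : ℝ) ≤
      η * Fintype.card V)
    (hY : ((∑ x, ∑ y, defectInd e x b a y d + ∑ x, ∑ y, defectInd e a x c d y +
      ∑ x, ∑ y, defectInd e x c d y a : ℤ) : ℝ) ≤ η * (Fintype.card V : ℝ) ^ 2) :
    ∃ S, NearBlowUp e (20 * η) S := by
  classical
  set n : ℝ := ((Fintype.card V : ℕ) : ℝ) with hn
  have hn0 : 0 < n := by
    rw [hn]
    exact_mod_cast hV
  have hp' : e a b = true ∧ e b c = true ∧ e c d = true ∧ e a c = false ∧ e a d = false ∧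
      e b d = false := by
    unfold pathInd at hp
    have : (e a b && e b c && e c d && !e a c && !e a d && !e b d) = true := by
      cases h : (e a b && e b c && e c d && !e a c && !e a d && !e b d)
      · rw [h] at hp
        exact absurd hp (by decide)
      · rfl
    simpa [and_assoc] using this
  obtain ⟨hab, hbc, hcd, hac, had, hbd⟩ := hp'
  have hba := (he b a).trans hab
  have hcb := (he c b).trans hbc
  have hdc := (he d c).trans hcd
  have hca := (he c a).trans hac
  have hda := (he d a).trans had
  have hdb := (he d b).trans hbd
  have hD := defectInd_nonneg e
  set V₁ : Finset V := {x | e b x = true ∧ e d x = false} with hV₁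
  set V₂ : Finset V := {x | e c x = true ∧ e a x = true} with hV₂
  set V₃ : Finset V := {x | e b x = true ∧ e d x = true} with hV₃
  set V₄ : Finset V := {x | e c x = true ∧ e a x = false} with hV₄
  set V₅ : Finset V := {x | e a x = true ∧ e d x = true} with hV₅
  have m₁ : ∀ x ∈ V₁, e a x = false ∧ e b x = true ∧ e c x = false ∧ e d x = false := by
    intro x hx
    simp only [hV₁, mem_filter, mem_univ, true_and] at hx
    exact ⟨ht b a x hba hx.1, hx.1, ht b c x hbc hx.1, hx.2⟩
  have m₂ : ∀ x ∈ V₂, e a x = true ∧ e b x = false ∧ e c x = true ∧ e d x = false := by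
    intro x hx
    simp only [hV₂, mem_filter, mem_univ, true_and] at hx
    exact ⟨hx.2, ht a b x hab hx.2, hx.1, ht c d x hcd hx.1⟩
  have m₃ : ∀ x ∈ V₃, e a x = false ∧ e b x = true ∧ e c x = false ∧ e d x = true := by
    intro x hx
    simp only [hV₃, mem_filter, mem_univ, true_and] at hx
    exact ⟨ht b a x hba hx.1, hx.1, ht b c x hbc hx.1, hx.2⟩
  have m₄ : ∀ x ∈ V₄, e a x = false ∧ e b x = false ∧ e c x = true ∧ e d x = false := by
    intro x hx
    simp only [hV₄, mem_filter, mem_univ, true_and] at hx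
    exact ⟨hx.2, ht c b x hcb hx.1, hx.1, ht c d x hcd hx.1⟩
  have m₅ : ∀ x ∈ V₅, e a x = true ∧ e b x = false ∧ e c x = false ∧ e d x = true := by
    intro x hx
    simp only [hV₅, mem_filter, mem_univ, true_and] at hx
    exact ⟨hx.1, ht a b x hab hx.1, ht d c x hdc hx.2, hx.2⟩
  -- the sizes of the classes
  set Q₁ : Finset V := {x | e a x = false ∧ e b x = false ∧ e c x = false} with hQ₁
  set Q₂ : Finset V := {x | e b x = false ∧ e c x = false ∧ e d x = false} with hQ₂
  have q₁ : (#Q₁ : ℤ) ≤ ∑ x, defectInd e a b c d x := by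
    refine card_le_sum_of_eq_one (fun x => hD _ _ _ _ _) fun x hx => ?_
    simp only [hQ₁, mem_filter, mem_univ, true_and] at hx
    exact defectInd_eq_one hab hbc hcd hac had hbd hx.1 hx.2.1 hx.2.2
  have q₂ : (#Q₂ : ℤ) ≤ ∑ x, defectInd e d c b a x := by
    refine card_le_sum_of_eq_one (fun x => hD _ _ _ _ _) fun x hx => ?_
    simp only [hQ₂, mem_filter, mem_univ, true_and] at hx
    exact defectInd_eq_one hdc hcb hba hdb hda hca hx.2.2 hx.2.1 hx.1
  have c₁ := card_filter_and_add (e b) (e d)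
  have c₂ := card_filter_and_add (e c) (e a)
  have d₁ : Disjoint V₂ V₅ := by
    rw [Finset.disjoint_left]
    intro x h₁ h₂
    simpa [(m₂ x h₁).2.2.1] using (m₅ x h₂).2.2.1
  have d₂ : Disjoint V₃ V₅ := by
    rw [Finset.disjoint_left]
    intro x h₁ h₂
    simpa [(m₃ x h₁).2.1] using (m₅ x h₂).2.1
  have d₃ : Disjoint (univ.filter fun x => e b x = true) (univ.filter fun x => e c x = true) := by
    rw [Finset.disjoint_left]
    intro x h₁ h₂
    simp only [mem_filter, mem_univ, true_and] at h₁ h₂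
    simpa [h₂] using ht b c x hbc h₁
  have d₄ : Disjoint ((univ.filter fun x => e b x = true) ∪ (univ.filter fun x => e c x = true))
      V₅ := by
    rw [Finset.disjoint_left]
    intro x h₁ h₂
    simp only [mem_union, mem_filter, mem_univ, true_and] at h₁
    have := m₅ x h₂
    simp [this.2.1, this.2.2.1] at h₁
  have c₃ : #V₂ + #V₅ ≤ #{x | e a x = true} := by
    rw [← Finset.card_union_of_disjoint d₁]
    refine Finset.card_le_card fun x hx => ?_
    simp only [mem_filter, mem_univ, true_and]
    rcases Finset.mem_union.1 hx with h | h
    exacts [(m₂ x h).1, (m₅ x h).1]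
  have c₄ : #{x | e a x = true} ≤ #V₂ + #V₅ + #Q₂ := by
    refine (Finset.card_le_card (t := V₂ ∪ V₅ ∪ Q₂) fun x hx => ?_).trans
      ((Finset.card_union_le _ _).trans (Nat.add_le_add_right (Finset.card_union_le _ _) _))
    simp only [mem_filter, mem_univ, true_and] at hx
    have hb := ht a b x hab hx
    simp only [hV₂, hV₅, hQ₂, mem_union, mem_filter, mem_univ, true_and, hx, hb]
    cases e c x <;> cases e d x <;> simp
  have c₅ : #V₃ + #V₅ ≤ #{x | e d x = true} := by
    rw [← Finset.card_union_of_disjoint d₂]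
    refine Finset.card_le_card fun x hx => ?_
    simp only [mem_filter, mem_univ, true_and]
    rcases Finset.mem_union.1 hx with h | h
    exacts [(m₃ x h).2.2.2, (m₅ x h).2.2.2]
  have c₆ : #{x | e d x = true} ≤ #V₃ + #V₅ + #Q₁ := by
    refine (Finset.card_le_card (t := V₃ ∪ V₅ ∪ Q₁) fun x hx => ?_).trans
      ((Finset.card_union_le _ _).trans (Nat.add_le_add_right (Finset.card_union_le _ _) _))
    simp only [mem_filter, mem_univ, true_and] at hx
    have hb := ht d c x hdc hx
    simp only [hV₃, hV₅, hQ₁, mem_union, mem_filter, mem_univ, true_and, hx, hb]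
    cases e a x <;> cases e b x <;> simp
  have c₇ : #{x | e b x = true} + #{x | e c x = true} + #V₅ ≤ Fintype.card V := by
    rw [← Finset.card_union_of_disjoint d₃, ← Finset.card_union_of_disjoint d₄]
    exact Finset.card_le_univ _
  have c₈ : Fintype.card V ≤ #{x | e b x = true} + #{x | e c x = true} + #V₅ + #Q₁ + #Q₂ := by
    rw [← Finset.card_union_of_disjoint d₃, ← Finset.card_union_of_disjoint d₄, ← Finset.card_univ]
    refine (Finset.card_le_card (t := _ ∪ Q₁ ∪ Q₂) fun x _ => ?_).trans
      ((Finset.card_union_le _ _).trans (Nat.add_le_add_right (Finset.card_union_le _ _) _))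
    simp only [hV₅, hQ₁, hQ₂, mem_union, mem_filter, mem_univ, true_and]
    cases e a x <;> cases e b x <;> cases e c x <;> cases e d x <;> simp
  have da := abs_le.1 (hdev a (by simp))
  have db := abs_le.1 (hdev b (by simp))
  have dc := abs_le.1 (hdev c (by simp))
  have dd := abs_le.1 (hdev d (by simp))
  have fa : (5 * #{x | e a x = true} : ℝ) = 2 * n + degDev e a := by
    rw [hn]
    exact_mod_cast five_mul_card_neighbors e a
  have fb : (5 * #{x | e b x = true} : ℝ) = 2 * n + degDev e b := by
    rw [hn]
    exact_mod_cast five_mul_card_neighbors e b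
  have fc : (5 * #{x | e c x = true} : ℝ) = 2 * n + degDev e c := by
    rw [hn]
    exact_mod_cast five_mul_card_neighbors e c
  have fd : (5 * #{x | e d x = true} : ℝ) = 2 * n + degDev e d := by
    rw [hn]
    exact_mod_cast five_mul_card_neighbors e d
  have hQ : (#Q₁ + #Q₂ : ℝ) ≤ η * n := by
    refine le_trans ?_ hX
    exact_mod_cast add_le_add q₁ q₂
  have r₁ : (#V₃ + #V₁ : ℝ) = #{x | e b x = true} := by exact_mod_cast c₁
  have r₂ : (#V₂ + #V₄ : ℝ) = #{x | e c x = true} := by exact_mod_cast c₂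
  have r₃ : (#V₂ + #V₅ : ℝ) ≤ #{x | e a x = true} := by exact_mod_cast c₃
  have r₄ : (#{x | e a x = true} : ℝ) ≤ #V₂ + #V₅ + #Q₂ := by exact_mod_cast c₄
  have r₅ : (#V₃ + #V₅ : ℝ) ≤ #{x | e d x = true} := by exact_mod_cast c₅
  have r₆ : (#{x | e d x = true} : ℝ) ≤ #V₃ + #V₅ + #Q₁ := by exact_mod_cast c₆
  have r₇ : (#{x | e b x = true} + #{x | e c x = true} + #V₅ : ℝ) ≤ n := by
    rw [hn]
    exact_mod_cast c₇
  have r₈ : n ≤ (#{x | e b x = true} + #{x | e c x = true} + #V₅ + #Q₁ + #Q₂ : ℝ) := by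
    rw [hn]
    exact_mod_cast c₈
  have hQ₁0 : (0 : ℝ) ≤ #Q₁ := Nat.cast_nonneg _
  have hQ₂0 : (0 : ℝ) ≤ #Q₂ := Nat.cast_nonneg _
  -- The disjoint neighbourhoods of b and c leave about n/5 vertices for `V₅`. The degrees of a and
  -- d then give `V₂` and `V₃`, and those of c and b give `V₄` and `V₁`.
  have b₅ : |(#V₅ : ℝ) - n / 5| ≤ 4 * (η * n) := abs_le.2 ⟨by linarith, by linarith⟩
  have b₂ : |(#V₂ : ℝ) - n / 5| ≤ 4 * (η * n) := abs_le.2 ⟨by linarith, by linarith⟩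
  have b₃ : |(#V₃ : ℝ) - n / 5| ≤ 4 * (η * n) := abs_le.2 ⟨by linarith, by linarith⟩
  have b₁ : |(#V₁ : ℝ) - n / 5| ≤ 4 * (η * n) := abs_le.2 ⟨by linarith, by linarith⟩
  have b₄ : |(#V₄ : ℝ) - n / 5| ≤ 4 * (η * n) := abs_le.2 ⟨by linarith, by linarith⟩
  -- the missing edges
  have p₁ : 0 ≤ ∑ x, ∑ y, defectInd e x b a y d :=
    Finset.sum_nonneg fun x _ => Finset.sum_nonneg fun y _ => hD _ _ _ _ _
  have p₂ : 0 ≤ ∑ x, ∑ y, defectInd e a x c d y :=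
    Finset.sum_nonneg fun x _ => Finset.sum_nonneg fun y _ => hD _ _ _ _ _
  have p₃ : 0 ≤ ∑ x, ∑ y, defectInd e x c d y a :=
    Finset.sum_nonneg fun x _ => Finset.sum_nonneg fun y _ => hD _ _ _ _ _
  have miss : ∀ (A B : Finset V), (#{p ∈ A ×ˢ B | e p.1 p.2 = false} : ℤ) ≤
      ∑ x, ∑ y, defectInd e x b a y d + ∑ x, ∑ y, defectInd e a x c d y +
      ∑ x, ∑ y, defectInd e x c d y a →
      (#{p ∈ A ×ˢ B | e p.1 p.2 = false} : ℝ) ≤ η * n ^ 2 := fun A B h =>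
    le_trans (by exact_mod_cast h) hY
  -- A missing pair x ∈ `V₁`, y ∈ `V₂` makes x b a y an induced path whose first three vertices miss
  -- d. The same sum also serves `V₅` and `V₁`, and the sum over x c d y with a serves both `V₃` and
  -- `V₅` against `V₄`.
  have i₁ : (#{p ∈ V₁ ×ˢ V₂ | e p.1 p.2 = false} : ℝ) ≤ η * n ^ 2 := by
    refine miss _ _ ?_
    have := card_missing_le_sum (e := e) (A := V₁) (B := V₂) (D := fun x y => defectInd e x b a y d)
      (fun x y => hD _ _ _ _ _) fun x hx y hy hxy => by
        obtain ⟨x₁, x₂, x₃, x₄⟩ := m₁ x hx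
        obtain ⟨y₁, y₂, y₃, y₄⟩ := m₂ y hy
        exact defectInd_eq_one ((he x b).trans x₂) hba y₁ ((he x a).trans x₁) hxy y₂
          ((he x d).trans x₄) hbd had
    linarith
  have i₂ : (#{p ∈ V₂ ×ˢ V₃ | e p.1 p.2 = false} : ℝ) ≤ η * n ^ 2 := by
    refine miss _ _ ?_
    have := card_missing_le_sum (e := e) (A := V₂) (B := V₃) (D := fun x y => defectInd e a x c d y)
      (fun x y => hD _ _ _ _ _) fun x hx y hy hxy => by
        obtain ⟨x₁, x₂, x₃, x₄⟩ := m₂ x hx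
        obtain ⟨y₁, y₂, y₃, y₄⟩ := m₃ y hy
        exact defectInd_eq_one x₁ ((he x c).trans x₃) hcd hac had ((he x d).trans x₄) y₁ hxy y₃
    linarith
  have i₃ : (#{p ∈ V₃ ×ˢ V₄ | e p.1 p.2 = false} : ℝ) ≤ η * n ^ 2 := by
    refine miss _ _ ?_
    have := card_missing_le_sum (e := e) (A := V₃) (B := V₄) (D := fun y x => defectInd e x c d y a)
      (fun x y => hD _ _ _ _ _) fun y hy x hx hyx => by
        obtain ⟨x₁, x₂, x₃, x₄⟩ := m₄ x hx
        obtain ⟨y₁, y₂, y₃, y₄⟩ := m₃ y hy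
        exact defectInd_eq_one ((he x c).trans x₃) hcd y₄ ((he x d).trans x₄) ((he x y).trans hyx)
          y₃ ((he x a).trans x₁) hca hda
    rw [Finset.sum_comm] at this
    linarith
  have i₄ : (#{p ∈ V₅ ×ˢ V₄ | e p.1 p.2 = false} : ℝ) ≤ η * n ^ 2 := by
    refine miss _ _ ?_
    have := card_missing_le_sum (e := e) (A := V₅) (B := V₄) (D := fun y x => defectInd e x c d y a)
      (fun x y => hD _ _ _ _ _) fun y hy x hx hyx => by
        obtain ⟨x₁, x₂, x₃, x₄⟩ := m₄ x hx
        obtain ⟨y₁, y₂, y₃, y₄⟩ := m₅ y hy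
        exact defectInd_eq_one ((he x c).trans x₃) hcd y₄ ((he x d).trans x₄) ((he x y).trans hyx)
          y₃ ((he x a).trans x₁) hca hda
    rw [Finset.sum_comm] at this
    linarith
  have i₅ : (#{p ∈ V₅ ×ˢ V₁ | e p.1 p.2 = false} : ℝ) ≤ η * n ^ 2 := by
    refine miss _ _ ?_
    have := card_missing_le_sum (e := e) (A := V₅) (B := V₁) (D := fun y x => defectInd e x b a y d)
      (fun x y => hD _ _ _ _ _) fun y hy x hx hyx => by
        obtain ⟨x₁, x₂, x₃, x₄⟩ := m₁ x hx
        obtain ⟨y₁, y₂, y₃, y₄⟩ := m₅ y hy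
        exact defectInd_eq_one ((he x b).trans x₂) hba y₁ ((he x a).trans x₁) ((he x y).trans hyx)
          y₂ ((he x d).trans x₄) hbd had
    rw [Finset.sum_comm] at this
    linarith
  -- refining the first and the fourth class
  have hηn : η * n ≤ n / 1000 := by nlinarith
  have hm : n / 6 ≤ #V₅ := by linarith [(abs_le.1 b₅).1]
  -- `V₁` and `V₄` are the only non-consecutive classes without a common neighbour among a, b, c, d.
  -- A typical w in `V₅` supplies one at the cost of 12ηn vertices; with the error 4ηn in the sizes
  -- this stays below 20ηn.
  obtain ⟨w, hw, hw'⟩ := exists_mem_card_nonadj_le (by positivity) hm i₅ i₄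
  have hw'' : 2 * (η * n ^ 2) / (n / 6) = 12 * (η * n) := by
    field_simp
    norm_num
  rw [hw''] at hw'
  set U₁ : Finset V := {x ∈ V₁ | e w x = true} with hU₁
  set U₄ : Finset V := {x ∈ V₄ | e w x = true} with hU₄
  have k₁ : (#U₁ + #{x ∈ V₁ | e w x = false} : ℝ) = #V₁ := by
    have := Finset.card_filter_add_card_filter_not (s := V₁) (fun x => e w x = true)
    simp only [Bool.not_eq_true] at this
    exact_mod_cast this
  have k₄ : (#U₄ + #{x ∈ V₄ | e w x = false} : ℝ) = #V₄ := by
    have := Finset.card_filter_add_card_filter_not (s := V₄) (fun x => e w x = true)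
    simp only [Bool.not_eq_true] at this
    exact_mod_cast this
  have u₁ : ∀ x ∈ U₁, x ∈ V₁ := fun x hx => Finset.mem_of_mem_filter x hx
  have u₄ : ∀ x ∈ U₄, x ∈ V₄ := fun x hx => Finset.mem_of_mem_filter x hx
  have z₁ : (0 : ℝ) ≤ #{x ∈ V₁ | e w x = false} := Nat.cast_nonneg _
  have z₄ : (0 : ℝ) ≤ #{x ∈ V₄ | e w x = false} := Nat.cast_nonneg _
  have sub : ∀ A B A' B' : Finset V, A ⊆ A' → B ⊆ B' →
      (#{p ∈ A' ×ˢ B' | e p.1 p.2 = false} : ℝ) ≤ η * n ^ 2 →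
      (#{p ∈ A ×ˢ B | e p.1 p.2 = false} : ℝ) ≤ 20 * η * n ^ 2 := by
    intro A B A' B' hA hB h
    have h₁ : #{p ∈ A ×ˢ B | e p.1 p.2 = false} ≤ #{p ∈ A' ×ˢ B' | e p.1 p.2 = false} :=
      Finset.card_le_card (Finset.filter_subset_filter _ (Finset.product_subset_product hA hB))
    have h₂ : (#{p ∈ A ×ˢ B | e p.1 p.2 = false} : ℝ) ≤ #{p ∈ A' ×ˢ B' | e p.1 p.2 = false} := by
      exact_mod_cast h₁
    have : 0 < η * n ^ 2 := by positivity
    linarith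
  have swap : ∀ A B : Finset V, #{p ∈ A ×ˢ B | e p.1 p.2 = false} =
      #{p ∈ B ×ˢ A | e p.1 p.2 = false} := by
    intro A B
    refine Finset.card_bij' (fun p _ => p.swap) (fun p _ => p.swap) ?_ ?_ ?_ ?_
    · intro p hp
      simp only [mem_filter, mem_product, Prod.fst_swap, Prod.snd_swap] at hp ⊢
      exact ⟨hp.1.symm, (he _ _).trans hp.2⟩
    · intro p hp
      simp only [mem_filter, mem_product, Prod.fst_swap, Prod.snd_swap] at hp ⊢
      exact ⟨hp.1.symm, (he _ _).trans hp.2⟩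
    · intro p _
      rfl
    · intro p _
      rfl
  refine ⟨![U₁, V₂, V₃, U₄, V₅], ?_, ?_, ?_, ?_⟩
  · have hpos : 0 < η * n := by positivity
    intro i
    rw [abs_le] at b₁ b₂ b₃ b₄ b₅ ⊢
    fin_cases i <;> constructor <;> simp <;> linarith
  · intro i j x hi hj
    have key : ∀ i : Fin 5, x ∈ ![U₁, V₂, V₃, U₄, V₅] i →
        e a x = ![false, true, false, false, true] i ∧
          e b x = ![true, false, true, false, false] i ∧
        e c x = ![false, true, false, true, false] i ∧
        e d x = ![false, false, true, false, true] i := by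
      intro i hi
      fin_cases i
      exacts [m₁ x (u₁ x hi), m₂ x hi, m₃ x hi, m₄ x (u₄ x hi), m₅ x hi]
    have h₁ := key i hi
    rw [(key j hj).1, (key j hj).2.1, (key j hj).2.2.1, (key j hj).2.2.2] at h₁
    revert h₁
    clear hi hj
    revert i j
    decide
  · intro i j h₁ h₂ x hx y hy
    -- Each class lies in the neighbourhoods of two of a, b, c, d, w. Equal or non-consecutive
    -- classes share one of these, so an edge between them would close a triangle.
    have key : ∀ i : Fin 5, ∀ x ∈ ![U₁, V₂, V₃, U₄, V₅] i,
        e (![a, b, c, d, w] (![1, 0, 1, 2, 0] i)) x = true ∧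
        e (![a, b, c, d, w] (![4, 2, 3, 4, 3] i)) x = true := by
      intro i x hx
      fin_cases i
      exacts [⟨(m₁ x (u₁ x hx)).2.1, (Finset.mem_filter.1 hx).2⟩, ⟨(m₂ x hx).1, (m₂ x hx).2.2.1⟩,
        ⟨(m₃ x hx).2.1, (m₃ x hx).2.2.2⟩, ⟨(m₄ x (u₄ x hx)).2.2.1, (Finset.mem_filter.1 hx).2⟩,
        ⟨(m₅ x hx).1, (m₅ x hx).2.2.2⟩]
    have lab : ∀ i j : Fin 5, j ≠ i + 1 → i ≠ j + 1 →
        (![1, 0, 1, 2, 0] i : Fin 5) = ![1, 0, 1, 2, 0] j ∨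
        (![1, 0, 1, 2, 0] i : Fin 5) = ![4, 2, 3, 4, 3] j ∨
        (![4, 2, 3, 4, 3] i : Fin 5) = ![1, 0, 1, 2, 0] j ∨
        (![4, 2, 3, 4, 3] i : Fin 5) = ![4, 2, 3, 4, 3] j := by decide
    obtain ⟨x₁, x₂⟩ := key i x hx
    obtain ⟨y₁, y₂⟩ := key j y hy
    rcases lab i j h₁ h₂ with h | h | h | h
    · rw [h] at x₁
      exact ht _ _ _ x₁ y₁
    · rw [h] at x₁
      exact ht _ _ _ x₁ y₂
    · rw [h] at x₂
      exact ht _ _ _ x₂ y₁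
    · rw [h] at x₂
      exact ht _ _ _ x₂ y₂
  · intro i
    fin_cases i
    · exact sub _ _ _ _ (fun x hx => u₁ x hx) subset_rfl i₁
    · exact sub _ _ _ _ subset_rfl subset_rfl i₂
    · exact sub _ _ _ _ subset_rfl (fun x hx => u₄ x hx) i₃
    · refine sub _ _ _ _ (fun x hx => u₄ x hx) subset_rfl ?_
      rw [swap]
      exact i₄
    · exact sub _ _ _ _ subset_rfl (fun x hx => u₁ x hx) i₅

end Patterns

/-! ### From the approximate structure to a homomorphism into the five-cycle -/

/-- A vertex cover of C₅ has an independent complement, which is contained in some {j + 1, j + 4}.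
-/
theorem exists_small_triple {p : Fin 5 → Prop} (h : ∀ i, p i ∨ p (i + 1)) :
    ∃ j, p j ∧ p (j + 2) ∧ p (j + 3) := by
  classical
  have key : ∀ q : Fin 5 → Bool, (∀ i, q i = true ∨ q (i + 1) = true) →
      ∃ j, q j = true ∧ q (j + 2) = true ∧ q (j + 3) = true := by decide
  simpa using key (fun i => decide (p i)) (by simpa using h)

/-- Here a and b are the densities of neighbours and non-neighbours of a vertex in the five classes.
Triangle-freeness makes a small outside two classes j + 1 and j + 4. The remaining three classes
already account for nearly 3/25 in the cubic sum, so 121/1000 leaves almost no room for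
non-neighbours in those two. -/
theorem exists_large_neighbors {a b : Fin 5 → ℝ} (hb : ∀ i, 0 ≤ b i)
    (hs : ∀ i, |a i + b i - 1 / 5| ≤ 1 / 10 ^ 6) (hp : ∀ i, a i * a (i + 1) ≤ 1 / 10 ^ 6)
    (hW : ∑ i, ((b i + b (i + 2)) ^ 3 - b i ^ 3) ≤ 121 / 1000) :
    ∃ j, 3 / 20 ≤ a (j + 1) ∧ 3 / 20 ≤ a (j + 4) := by
  have h₁ : ∀ i, a i ≤ 1 / 1000 ∨ a (i + 1) ≤ 1 / 1000 := by
    intro i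
    by_contra! h
    nlinarith [hp i]
  obtain ⟨j, h₀, h₂, h₃⟩ := exists_small_triple h₁
  refine ⟨j, ?_⟩
  rw [← Equiv.sum_comp (Equiv.addLeft j)] at hW
  simp only [Equiv.coe_addLeft, Fin.sum_univ_five, add_assoc, Fin.reduceAdd, add_zero] at hW
  -- 0.1989 lies just below 1/5 - 1/1000 - 1/10⁶.
  have l : ∀ i, a i ≤ 1 / 1000 → 0.1989 ≤ b i := fun i hi => by
    have := (abs_le.1 (hs i)).1
    norm_num at this ⊢
    linarith
  have l₀ := l _ h₀
  have l₂ := l _ h₂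
  have l₃ := l _ h₃
  have b₁ := hb (j + 1)
  have b₄ := hb (j + 4)
  have s₁ := (abs_le.1 (hs (j + 1))).1
  have s₄ := (abs_le.1 (hs (j + 4))).1
  have m1 : ∀ x y : ℝ, 0.1989 ≤ x → 0.1989 ≤ y → 7 * 0.1989 ^ 3 ≤ (x + y) ^ 3 - x ^ 3 := by
    intro x y hx hy
    have e₁ : (x + y) ^ 3 - x ^ 3 = 3 * x * y * (x + y) + y ^ 3 := by ring
    have e₂ : (0.1989 : ℝ) * 0.1989 ≤ x * y := mul_le_mul hx hy (by norm_num) (by linarith)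
    have e₃ : (0.1989 : ℝ) * 0.1989 * (0.1989 + 0.1989) ≤ x * y * (x + y) :=
      mul_le_mul e₂ (by linarith) (by norm_num) (by nlinarith)
    have e₄ : (0.1989 : ℝ) ^ 3 ≤ y ^ 3 := pow_le_pow_left₀ (by norm_num) hy 3
    rw [e₁]
    linarith
  have m2 : ∀ x y : ℝ, 0 ≤ x → 0.1989 ≤ y →
      0.1989 ^ 3 + 3 * 0.1989 ^ 2 * x ≤ (x + y) ^ 3 - x ^ 3 := by
    intro x y hx hy
    have e₁ : (x + y) ^ 3 - x ^ 3 = 3 * y ^ 2 * x + 3 * (x ^ 2 * y) + y ^ 3 := by ring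
    have e₂ : (0.1989 : ℝ) ^ 2 ≤ y ^ 2 := pow_le_pow_left₀ (by norm_num) hy 2
    have e₄ : (0.1989 : ℝ) ^ 3 ≤ y ^ 3 := pow_le_pow_left₀ (by norm_num) hy 3
    have e₅ : 0 ≤ x ^ 2 * y := by positivity
    rw [e₁]
    nlinarith
  have m3 : ∀ x y : ℝ, 0 ≤ x → 0.1989 ≤ y →
      3 * 0.1989 ^ 2 * x ≤ (y + x) ^ 3 - y ^ 3 := by
    intro x y hx hy
    have e₁ : (y + x) ^ 3 - y ^ 3 = 3 * y ^ 2 * x + 3 * (x ^ 2 * y) + x ^ 3 := by ring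
    have e₂ : (0.1989 : ℝ) ^ 2 ≤ y ^ 2 := pow_le_pow_left₀ (by norm_num) hy 2
    have e₄ : 0 ≤ x ^ 3 := by positivity
    have e₅ : 0 ≤ x ^ 2 * y := by positivity
    rw [e₁]
    nlinarith
  have m4 : 0 ≤ (b (j + 4) + b (j + 1)) ^ 3 - b (j + 4) ^ 3 :=
    sub_nonneg.2 (pow_le_pow_left₀ b₄ (by linarith) 3)
  have t₀ := m1 _ _ l₀ l₂
  have t₁ := m2 _ _ b₁ l₃
  have t₂ := m3 _ _ b₄ l₂
  have t₃ := m1 _ _ l₃ l₀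
  norm_num at hW t₀ t₁ t₂ t₃ s₁ s₄ ⊢
  constructor <;> linarith

section Patterns

variable {V : Type*} [Fintype V] {e : V → V → Bool}

theorem indepInd_nonneg {V : Type*} (e : V → V → Bool) (a b c d : V) : 0 ≤ indepInd e a b c d :=
  cond_nonneg le_rfl zero_le_one

/-- The indicator of `x ∈ B`. -/
noncomputable def memInd (B : Finset V) (x : V) : ℤ := by
  classical exact if x ∈ B then 1 else 0

theorem sum_memInd (B : Finset V) : ∑ x, memInd B x = B.card := by
  classical
  simp [memInd]

open Finset in
-- The maximal independent sets of C₅ are the pairs {i, i + 2}. A triple inside one class is covered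
-- by two such pairs, whence the subtracted cube; any other independent choice of classes is covered
-- by exactly one.
theorem sum_cubes_le_sum_indepInd {v : V} {B : Fin 5 → Finset V}
    (hB : ∀ i j x, x ∈ B i → x ∈ B j → i = j) (hv : ∀ i, ∀ x ∈ B i, e v x = false)
    (hadj : ∀ i j, j ≠ i + 1 → i ≠ j + 1 → ∀ x ∈ B i, ∀ y ∈ B j, e x y = false) :
    ∑ i, ((#(B i) + #(B (i + 2)) : ℤ) ^ 3 - #(B i) ^ 3) ≤ ∑ x, ∑ y, ∑ z, indepInd e v x y z := by
  set β : Fin 5 → V → ℤ := fun i => memInd (B i) with hβ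
  have key : ∀ x y z, ∑ i, ((β i x + β (i + 2) x) * (β i y + β (i + 2) y) * (β i z + β (i + 2) z)
      - β i x * β i y * β i z) ≤ indepInd e v x y z := by
    intro x y z
    have h₀ : ∀ x, (∀ i, β i x = 0) ∨ ∃ j, x ∈ B j ∧ ∀ i, β i x = if i = j then 1 else 0 := by
      intro x
      by_cases h : ∃ j, x ∈ B j
      · obtain ⟨j, hj⟩ := h
        refine Or.inr ⟨j, hj, fun i => ?_⟩
        simp only [hβ, memInd]
        by_cases hij : i = j
        · simp [hij, hj]
        · rw [if_neg (fun hi => hij (hB i j x hi hj)), if_neg hij]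
      · push Not at h
        exact Or.inl fun i => by simp [hβ, memInd, h i]
    rcases h₀ x with hx | ⟨i, hx, hx'⟩
    · simpa [hx] using indepInd_nonneg e v x y z
    rcases h₀ y with hy | ⟨j, hy, hy'⟩
    · simpa [hy] using indepInd_nonneg e v x y z
    rcases h₀ z with hz | ⟨k, hz, hz'⟩
    · simpa [hz] using indepInd_nonneg e v x y z
    simp only [hx', hy', hz']
    by_cases hall : (j ≠ i + 1 ∧ i ≠ j + 1) ∧ (k ≠ i + 1 ∧ i ≠ k + 1) ∧ (k ≠ j + 1 ∧ j ≠ k + 1)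
    · have h₁ : indepInd e v x y z = 1 := by
        simp [indepInd, hv i x hx, hv j y hy, hv k z hz, hadj i j hall.1.1 hall.1.2 x hx y hy,
          hadj i k hall.2.1.1 hall.2.1.2 x hx z hz, hadj j k hall.2.2.1 hall.2.2.2 y hy z hz]
      rw [h₁]
      clear hall hx hy hz hx' hy' hz'
      revert i j k
      decide
    · refine le_trans (le_of_eq ?_) (indepInd_nonneg e v x y z)
      clear hx hy hz hx' hy' hz'
      revert i j k
      decide
  have h₁ := Finset.sum_le_sum fun x (_ : x ∈ univ) => Finset.sum_le_sum fun y (_ : y ∈ univ) =>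
    Finset.sum_le_sum fun z (_ : z ∈ univ) => key x y z
  refine le_trans (le_of_eq ?_) h₁
  have h₂ : ∀ F : V → V → V → Fin 5 → ℤ,
      ∑ x, ∑ y, ∑ z, ∑ i, F x y z i = ∑ i, ∑ x, ∑ y, ∑ z, F x y z i := by
    intro F
    rw [Finset.sum_congr rfl fun x _ =>
      (Finset.sum_congr rfl fun y _ => Finset.sum_comm).trans Finset.sum_comm, Finset.sum_comm]
  rw [h₂]
  refine Finset.sum_congr rfl fun i _ => ?_
  simp only [Finset.sum_sub_distrib, ← Finset.mul_sum, ← Finset.sum_mul, Finset.sum_add_distrib, hβ,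
    sum_memInd]
  ring

open Finset in
-- Assign to each vertex the class j for which it has at least 3n/20 neighbours in both classes j ±
-- 1. Adjacent vertices with equal or non-consecutive values would both have that many neighbours in
-- one class of size about n/5; those sets overlap, giving a triangle.
theorem NearBlowUp.exists_hom {S : Fin 5 → Finset V} (hS : NearBlowUp e (1 / 10 ^ 6) S)
    (hV : 0 < Fintype.card V)
    (ht : ∀ x y z, e x y = true → e x z = true → e y z = false)
    (hW : ∀ v, ((∑ x, ∑ y, ∑ z, indepInd e v x y z : ℤ) : ℝ) ≤
      121 / 1000 * (Fintype.card V : ℝ) ^ 3) :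
    ∃ φ : V → Fin 5, (∀ x y, e x y = true → φ y = φ x + 1 ∨ φ x = φ y + 1) ∧
      ∀ i, |(#{x | φ x = i} : ℝ) - Fintype.card V / 5| ≤ 5 / 10 ^ 6 * Fintype.card V := by
  set n : ℝ := ((Fintype.card V : ℕ) : ℝ) with hn
  have hn0 : 0 < n := by
    rw [hn]
    exact_mod_cast hV
  have hcard : ∀ v i, (#{x ∈ S i | e v x = true} + #{x ∈ S i | e v x = false} : ℝ) = #(S i) := by
    intro v i
    have := Finset.card_filter_add_card_filter_not (s := S i) (fun x => e v x = true)
    simp only [Bool.not_eq_true] at this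
    exact_mod_cast this
  have h₁ : ∀ v, ∃ j, 3 / 20 ≤ (#{x ∈ S (j + 1) | e v x = true} : ℝ) / n ∧
      3 / 20 ≤ (#{x ∈ S (j + 4) | e v x = true} : ℝ) / n := by
    intro v
    refine exists_large_neighbors (a := fun i => (#{x ∈ S i | e v x = true} : ℝ) / n)
      (b := fun i => (#{x ∈ S i | e v x = false} : ℝ) / n)
      (fun i => by positivity) (fun i => ?_) (fun i => ?_) ?_
    · have := hS.card_sub_le i
      rw [← hn] at this
      rw [← add_div, hcard, show (#(S i) : ℝ) / n - 1 / 5 = (#(S i) - n / 5) / n by field_simp,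
        abs_div, abs_of_pos hn0, div_le_iff₀ hn0]
      exact this
    · rw [div_mul_div_comm, div_le_iff₀ (by positivity), ← pow_two]
      refine le_trans ?_ (hS.card_missing_le i)
      rw [← Nat.cast_mul, ← Finset.card_product]
      refine Nat.cast_le.2 (Finset.card_le_card fun p hp => ?_)
      simp only [mem_product, mem_filter] at hp ⊢
      exact ⟨⟨hp.1.1, hp.2.1⟩, ht v _ _ hp.1.2 hp.2.2⟩
    · have h := sum_cubes_le_sum_indepInd (e := e) (v := v)
        (B := fun i => {x ∈ S i | e v x = false})
        (fun i j x hi hj => hS.eq_of_mem i j x (Finset.mem_of_mem_filter x hi)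
          (Finset.mem_of_mem_filter x hj))
        (fun i x hx => (Finset.mem_filter.1 hx).2)
        (fun i j h₁ h₂ x hx y hy => hS.nonadj i j h₁ h₂ x (Finset.mem_of_mem_filter x hx) y
          (Finset.mem_of_mem_filter y hy))
      have h' : (∑ i, ((#{x ∈ S i | e v x = false} + #{x ∈ S (i + 2) | e v x = false} : ℝ) ^ 3
          - #{x ∈ S i | e v x = false} ^ 3)) ≤ 121 / 1000 * n ^ 3 :=
        le_trans (by exact_mod_cast h) (hW v)
      rw [← div_le_iff₀ (by positivity), Finset.sum_div] at h'
      refine le_trans (le_of_eq (Finset.sum_congr rfl fun i _ => ?_)) h'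
      field_simp
  choose φ hφ using h₁
  have hφ' : ∀ v, 3 / 20 * n ≤ (#{x ∈ S (φ v + 1) | e v x = true} : ℝ) ∧
      3 / 20 * n ≤ (#{x ∈ S (φ v + 4) | e v x = true} : ℝ) := fun v =>
    ⟨(le_div_iff₀ hn0).1 (hφ v).1, (le_div_iff₀ hn0).1 (hφ v).2⟩
  refine ⟨φ, fun u v huv => ?_, ?_⟩
  · by_contra! hcon
    have hk : ∃ k, 3 / 20 * n ≤ (#{x ∈ S k | e u x = true} : ℝ) ∧
        3 / 20 * n ≤ (#{x ∈ S k | e v x = true} : ℝ) := by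
      have key : ∀ i j : Fin 5, j ≠ i + 1 ∧ i ≠ j + 1 →
          i + 1 = j + 1 ∨ i + 1 = j + 4 ∨ i + 4 = j + 1 ∨ i + 4 = j + 4 := by decide
      have hu := hφ' u
      have hv := hφ' v
      rcases key _ _ hcon with h | h | h | h
      · exact ⟨_, hu.1, h ▸ hv.1⟩
      · exact ⟨_, hu.1, h ▸ hv.2⟩
      · exact ⟨_, hu.2, h ▸ hv.1⟩
      · exact ⟨_, hu.2, h ▸ hv.2⟩
    obtain ⟨k, k₁, k₂⟩ := hk
    have hsub : #{x ∈ S k | e v x = true} ≤ #{x ∈ S k | e u x = false} := by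
      refine Finset.card_le_card fun x hx => ?_
      simp only [mem_filter] at hx ⊢
      refine ⟨hx.1, ?_⟩
      by_contra h
      rw [Bool.not_eq_false] at h
      simpa [hx.2] using ht u v x huv h
    have hsub' : (#{x ∈ S k | e v x = true} : ℝ) ≤ #{x ∈ S k | e u x = false} := by
      exact_mod_cast hsub
    have h₂ := (abs_le.1 (hS.card_sub_le k)).2
    rw [← hn] at h₂
    norm_num at h₂
    linarith [hcard u k]
  -- A vertex of `S i` has neighbours only in `S (i ± 1)`, so it is assigned i. The resulting lower
  -- bounds on all five fibres also bound each from above, as the sizes add up to n.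
  · have hsub : ∀ i, #(S i) ≤ #{x | φ x = i} := by
      intro i
      refine Finset.card_le_card fun v hv => ?_
      simp only [mem_filter, mem_univ, true_and]
      have key : ∀ i j : Fin 5, (j + 1 = i + 1 ∨ i = j + 1 + 1) → (j + 4 = i + 1 ∨ i = j + 4 + 1) →
          j = i := by decide
      have hne : ∀ k, 3 / 20 * n ≤ (#{x ∈ S k | e v x = true} : ℝ) → k = i + 1 ∨ i = k + 1 := by
        intro k hk
        by_contra! hcon
        have : #{x ∈ S k | e v x = true} = 0 := by
          rw [Finset.card_eq_zero, Finset.filter_eq_empty_iff]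
          intro x hx
          simp [hS.nonadj i k hcon.1 hcon.2 v hv x hx]
        rw [this] at hk
        norm_num at hk
        linarith
      exact key i (φ v) (hne _ (hφ' v).1) (hne _ (hφ' v).2)
    have hsum : ∑ i, (#{x | φ x = i} : ℝ) = n := by
      rw [hn, ← Finset.card_univ, Finset.card_eq_sum_card_fiberwise (f := φ) (t := univ)
        (fun x _ => by simp)]
      push_cast
      rfl
    have hlow : ∀ i, n / 5 - 1 / 10 ^ 6 * n ≤ (#{x | φ x = i} : ℝ) := by
      intro i
      have h₁ := (abs_le.1 (hS.card_sub_le i)).1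
      rw [← hn] at h₁
      have h₂ : (#(S i) : ℝ) ≤ #{x | φ x = i} := by exact_mod_cast hsub i
      linarith
    rw [Fin.sum_univ_five] at hsum
    have l₀ := hlow 0
    have l₁ := hlow 1
    have l₂ := hlow 2
    have l₃ := hlow 3
    have l₄ := hlow 4
    norm_num at l₀ l₁ l₂ l₃ l₄
    intro i
    rw [abs_le]
    norm_num
    fin_cases i <;> simp <;> constructor <;> linarith

end Patterns

/-! ### Counting four-cliques through a vertex -/

section Cliques

variable {V : Type*}

open scoped Classical in
/-- The Boolean adjacency relation of the complement of `G`. -/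
noncomputable def complAdj (G : SimpleGraph V) (x y : V) : Bool := decide (Gᶜ.Adj x y)

theorem complAdj_comm (G : SimpleGraph V) (x y : V) : complAdj G x y = complAdj G y x := by
  exact decide_eq_decide.2 (Gᶜ.adj_comm x y)

theorem adj_of_complAdj_eq_false {G : SimpleGraph V} {x y : V} (h : complAdj G x y = false)
    (hxy : x ≠ y) : G.Adj x y := by
  simpa [complAdj, hxy] using h

theorem complAdj_triangle {G : SimpleGraph V} (hG : G.IndepSetFree 3) (x y z : V)
    (hxy : complAdj G x y = true) (hxz : complAdj G x z = true) : complAdj G y z = false := by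
  classical
  rw [← SimpleGraph.cliqueFree_compl] at hG
  by_contra h
  simp only [complAdj, decide_eq_true_eq, decide_eq_false_iff_not, not_not] at hxy hxz h
  exact hG {x, y, z} (SimpleGraph.is3Clique_triple_iff.2 ⟨hxy, hxz, h⟩)

variable [Fintype V]

open scoped Classical in
/-- The four-cliques of `G` through `v`. -/
noncomputable def cliquesAt (G : SimpleGraph V) (v : V) : Finset (Finset V) :=
  {s ∈ G.cliqueFinset 4 | v ∈ s}

open scoped Classical in
theorem cliqueCount_eq_card (G : SimpleGraph V) (k : ℕ) :
    cliqueCount G k = (G.cliqueFinset k).card := by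
  rw [cliqueCount, ← SimpleGraph.coe_cliqueFinset, Set.ncard_coe_finset]

theorem sum_card_cliquesAt (G : SimpleGraph V) :
    ∑ v, (cliquesAt G v).card = 4 * cliqueCount G 4 := by
  classical
  rw [cliqueCount_eq_card]
  have h := Finset.sum_card_bipartiteAbove_eq_sum_card_bipartiteBelow
    (s := (Finset.univ : Finset V)) (t := G.cliqueFinset 4) (fun v s => v ∈ s)
  simp only [Finset.bipartiteAbove, Finset.bipartiteBelow] at h
  unfold cliquesAt
  rw [h, mul_comm, ← smul_eq_mul, ← Finset.sum_const]
  refine Finset.sum_congr rfl fun s hs => ?_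
  rw [SimpleGraph.mem_cliqueFinset_iff] at hs
  simpa using hs.card_eq

open Finset in
open scoped Classical in
theorem card_injective_insert_mem_le (v : V) (C : Finset (Finset V))
    (hC : ∀ s ∈ C, #s = 4 ∧ v ∈ s) :
    #{f : Fin 3 → V | (f.Injective ∧ v ∉ univ.image f) ∧ insert v (univ.image f) ∈ C} ≤
      6 * #C := by
  refine Finset.card_le_mul_card_image_of_maps_to (f := fun f => insert v (univ.image f))
    (fun f hf => (Finset.mem_filter.1 hf).2.2) 6 fun s hs => ?_
  obtain ⟨hs₄, hv⟩ := hC s hs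
  have h₃ : Fintype.card (Fin 3 ↪ (s.erase v : Finset V)) = 6 := by
    rw [Fintype.card_embedding_eq, Fintype.card_coe, Finset.card_erase_of_mem hv, hs₄]
    rfl
  rw [← h₃, ← Finset.card_univ]
  have hmem : ∀ f ∈ ({f ∈ ({f : Fin 3 → V | (f.Injective ∧ v ∉ univ.image f) ∧
      insert v (univ.image f) ∈ C} : Finset _) | insert v (univ.image f) = s} : Finset _),
      f.Injective ∧ ∀ i, f i ∈ s.erase v := by
    intro f hf
    simp only [mem_filter, mem_univ, true_and] at hf
    refine ⟨hf.1.1.1, fun i => ?_⟩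
    rw [← hf.2, Finset.erase_insert hf.1.1.2]
    exact Finset.mem_image_of_mem f (Finset.mem_univ i)
  refine Finset.card_le_card_of_surjOn (fun g i => (g i : V)) fun f hf => ?_
  obtain ⟨hf₁, hf₂⟩ := hmem f hf
  exact ⟨⟨fun i => ⟨f i, hf₂ i⟩, fun i j hij => hf₁ (congrArg Subtype.val hij)⟩, by simp, rfl⟩

open Finset in
-- Each clique through v gives 3! ordered triples; each of the six possible coincidences among v, x,
-- y, z accounts for at most n² further triples.
theorem sum_indepInd_le (G : SimpleGraph V) (v : V) :
    ∑ x, ∑ y, ∑ z, indepInd (complAdj G) v x y z ≤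
      6 * #(cliquesAt G v) + 6 * (Fintype.card V : ℤ) ^ 2 := by
  classical
  have h := card_injective_insert_mem_le v (cliquesAt G v) fun s hs => by
    simp only [cliquesAt, mem_filter, SimpleGraph.mem_cliqueFinset_iff] at hs
    exact ⟨hs.1.card_eq, hs.2⟩
  rw [Finset.card_filter] at h
  have hsum := sum_fin_succ_arrow (V := V) (n := 2) fun f =>
    if (f.Injective ∧ v ∉ univ.image f) ∧ insert v (univ.image f) ∈ cliquesAt G v
      then (1 : ℤ) else 0
  have h₁ : ∑ x, ∑ y, ∑ z, (if ((![x, y, z] : Fin 3 → V).Injective ∧ v ∉ univ.image ![x, y, z]) ∧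
      insert v (univ.image ![x, y, z]) ∈ cliquesAt G v then (1 : ℤ) else 0) ≤
      6 * #(cliquesAt G v) := by
    have h' : (∑ f : Fin 3 → V, if (f.Injective ∧ v ∉ univ.image f) ∧
        insert v (univ.image f) ∈ cliquesAt G v then (1 : ℤ) else 0) ≤ 6 * #(cliquesAt G v) := by
      exact_mod_cast h
    refine le_trans (le_of_eq ?_) h'
    rw [hsum]
    simp only [sum_fin_succ_arrow, Finset.univ_unique, Finset.sum_singleton]
    rfl
  have key : ∀ x y z, indepInd (complAdj G) v x y z ≤
      (if ((![x, y, z] : Fin 3 → V).Injective ∧ v ∉ univ.image ![x, y, z]) ∧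
      insert v (univ.image ![x, y, z]) ∈ cliquesAt G v then (1 : ℤ) else 0) +
      (if v = x then 1 else 0) + (if v = y then 1 else 0) + (if v = z then 1 else 0) +
      (if x = y then 1 else 0) + (if x = z then 1 else 0) + (if y = z then 1 else 0) := by
    intro x y z
    have hle : indepInd (complAdj G) v x y z ≤ 1 := by
      unfold indepInd
      generalize (complAdj G v x || _ || _ || _ || _ || _) = t
      cases t <;> simp
    have hn : ∀ p : Prop, ∀ _ : Decidable p, (0 : ℤ) ≤ if p then 1 else 0 := by
      intro p _
      split_ifs <;> norm_num
    by_cases hd : v = x ∨ v = y ∨ v = z ∨ x = y ∨ x = z ∨ y = z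
    · have a₁ := hn (((![x, y, z] : Fin 3 → V).Injective ∧ v ∉ univ.image ![x, y, z]) ∧
        insert v (univ.image ![x, y, z]) ∈ cliquesAt G v) inferInstance
      have a₂ := hn (v = x) inferInstance
      have a₃ := hn (v = y) inferInstance
      have a₄ := hn (v = z) inferInstance
      have a₅ := hn (x = y) inferInstance
      have a₆ := hn (x = z) inferInstance
      have a₇ := hn (y = z) inferInstance
      rcases hd with hd | hd | hd | hd | hd | hd <;> rw [if_pos hd] <;> linarith
    · push Not at hd
      obtain ⟨d₁, d₂, d₃, d₄, d₅, d₆⟩ := hd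
      rw [if_neg d₁, if_neg d₂, if_neg d₃, if_neg d₄, if_neg d₅, if_neg d₆]
      by_cases hi : indepInd (complAdj G) v x y z = 0
      · rw [hi]
        linarith [hn (((![x, y, z] : Fin 3 → V).Injective ∧ v ∉ univ.image ![x, y, z]) ∧
          insert v (univ.image ![x, y, z]) ∈ cliquesAt G v) inferInstance]
      · rw [if_pos]
        · linarith
        · simp only [indepInd, Bool.cond_eq_ite, ite_eq_left_iff, not_forall, Bool.not_eq_true,
            Bool.or_eq_false_iff] at hi
          obtain ⟨⟨⟨⟨⟨⟨b₁, b₂⟩, b₃⟩, b₄⟩, b₅⟩, b₆⟩, -⟩ := hi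
          have g₁ := adj_of_complAdj_eq_false b₁ d₁
          have g₂ := adj_of_complAdj_eq_false b₂ d₂
          have g₃ := adj_of_complAdj_eq_false b₃ d₄
          have g₄ := adj_of_complAdj_eq_false b₄ d₃
          have g₅ := adj_of_complAdj_eq_false b₅ d₅
          have g₆ := adj_of_complAdj_eq_false b₆ d₆
          have him : univ.image ![x, y, z] = {x, y, z} := by
            ext t
            simp [Fin.exists_fin_succ, eq_comm]
          rw [him]
          refine ⟨⟨?_, by simp [d₁, d₂, d₃]⟩, ?_⟩
          · intro i j hij
            fin_cases i <;> fin_cases j <;>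
              first
              | rfl
              | exact absurd hij d₄
              | exact absurd hij d₅
              | exact absurd hij d₆
              | exact absurd hij.symm d₄
              | exact absurd hij.symm d₅
              | exact absurd hij.symm d₆
          · simp only [cliquesAt, mem_filter, SimpleGraph.mem_cliqueFinset_iff, mem_insert_self,
              and_true]
            rw [SimpleGraph.isNClique_iff]
            constructor
            · simp [SimpleGraph.isClique_iff, Set.pairwise_insert, g₁, g₂, g₃, g₄, g₅, g₆,
                g₁.symm, g₂.symm, g₃.symm, g₄.symm, g₅.symm, g₆.symm]
            · rw [Finset.card_insert_of_notMem (by simp [d₁, d₂, d₃]),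
                Finset.card_eq_three.2 ⟨x, y, z, d₄, d₅, d₆, rfl⟩]
  have h₂ := Finset.sum_le_sum fun x (_ : x ∈ univ) => Finset.sum_le_sum fun y (_ : y ∈ univ) =>
    Finset.sum_le_sum fun z (_ : z ∈ univ) => key x y z
  simp only [Finset.sum_add_distrib, Finset.sum_const, Finset.sum_ite_eq, Finset.mem_univ, if_true,
    Finset.card_univ, nsmul_eq_mul, ← Finset.mul_sum, mul_one] at h₂
  linarith

/-! ### Cloning a vertex -/

open Finset in
-- Replace v by a clone of u in the complement, which stays triangle-free. Cliques avoiding v are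
-- unchanged. Those through the clone but not u correspond to cliques at u, and those through both
-- number at most n². Minimality gives the bound.
theorem card_cliquesAt_le_add {G : SimpleGraph V} (hG : G.IndepSetFree 3)
    (hmin : ∀ G' : SimpleGraph V, G'.IndepSetFree 3 → cliqueCount G 4 ≤ cliqueCount G' 4)
    (u v : V) : #(cliquesAt G v) ≤ #(cliquesAt G u) + Fintype.card V ^ 2 := by
  classical
  rcases eq_or_ne u v with rfl | huv
  · exact Nat.le_add_right _ _
  obtain ⟨G', hfree, hadj, hadj'⟩ : ∃ G' : SimpleGraph V, G'.IndepSetFree 3 ∧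
      (∀ x y, x ≠ v → y ≠ v → (G'.Adj x y ↔ G.Adj x y)) ∧
      ∀ y, y ≠ u → y ≠ v → (G'.Adj v y ↔ G.Adj u y) := by
    refine ⟨(Gᶜ.replaceVertex u v)ᶜ, ?_, fun x y hx hy => ?_, fun y hu hv => ?_⟩
    · rw [← SimpleGraph.cliqueFree_compl, compl_compl]
      rw [← SimpleGraph.cliqueFree_compl] at hG
      exact hG.replaceVertex u v
    · have := G.ne_of_adj (a := x) (b := y)
      simp only [SimpleGraph.compl_adj, SimpleGraph.replaceVertex, hx, hy, if_false]
      tauto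
    · simp only [SimpleGraph.compl_adj, SimpleGraph.replaceVertex, hv, if_false, if_true]
      simp [hu.symm, hv.symm]
  have hle := hmin G' hfree
  rw [cliqueCount_eq_card, cliqueCount_eq_card,
    ← Finset.card_filter_add_card_filter_not (s := G.cliqueFinset 4) (fun s => v ∈ s),
    ← Finset.card_filter_add_card_filter_not (s := G'.cliqueFinset 4) (fun s => v ∈ s)] at hle
  have heq : {s ∈ G'.cliqueFinset 4 | v ∉ s} = {s ∈ G.cliqueFinset 4 | v ∉ s} := by
    refine Finset.ext fun s => ?_
    simp only [mem_filter, SimpleGraph.mem_cliqueFinset_iff, SimpleGraph.isNClique_iff,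
      SimpleGraph.isClique_iff, Set.Pairwise, mem_coe]
    refine and_congr_left fun hv => and_congr_left fun _ => ?_
    exact forall₂_congr fun x hx => forall₂_congr fun y hy => imp_congr_right fun _ =>
      hadj x y (ne_of_mem_of_not_mem hx hv) (ne_of_mem_of_not_mem hy hv)
  have h₁ : #{s ∈ {s ∈ G'.cliqueFinset 4 | v ∈ s} | u ∈ s} ≤ Fintype.card V ^ 2 := by
    refine (Finset.card_le_card_of_injOn (t := powersetCard 2 univ)
      (fun s => (s.erase u).erase v) (fun s hs => ?_) fun s hs t ht hst => ?_).trans ?_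
    · simp only [coe_filter, mem_filter, SimpleGraph.mem_cliqueFinset_iff, Set.mem_ofPred_eq] at hs
      rw [Finset.mem_coe, Finset.mem_powersetCard]
      refine ⟨Finset.subset_univ _, ?_⟩
      rw [Finset.card_erase_of_mem (Finset.mem_erase.2 ⟨huv.symm, hs.1.2⟩),
        Finset.card_erase_of_mem hs.2, hs.1.1.card_eq]
    · simp only [coe_filter, mem_filter, Set.mem_ofPred_eq] at hs ht
      have e₁ : ∀ s : Finset V, v ∈ s → u ∈ s → insert u (insert v ((s.erase u).erase v)) = s := by
        intro s hv hu
        rw [Finset.insert_erase (Finset.mem_erase.2 ⟨huv.symm, hv⟩), Finset.insert_erase hu]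
      rw [← e₁ s hs.1.2 hs.2, ← e₁ t ht.1.2 ht.2]
      exact congrArg (fun r => insert u (insert v r)) hst
    · rw [Finset.card_powersetCard, Finset.card_univ]
      rw [Nat.choose_two_right, pow_two]
      exact (Nat.div_le_self _ _).trans (Nat.mul_le_mul_left _ (Nat.sub_le _ _))
  have h₂ : #{s ∈ {s ∈ G'.cliqueFinset 4 | v ∈ s} | u ∉ s} ≤ #(cliquesAt G u) := by
    refine Finset.card_le_card_of_injOn (fun s => insert u (s.erase v)) (fun s hs => ?_)
      fun s hs t ht hst => ?_
    · simp only [coe_filter, mem_filter, SimpleGraph.mem_cliqueFinset_iff, Set.mem_ofPred_eq] at hs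
      obtain ⟨⟨hs, hv⟩, hu⟩ := hs
      have hu' : u ∉ s.erase v := fun h => hu (Finset.mem_of_mem_erase h)
      simp only [cliquesAt, coe_filter, SimpleGraph.mem_cliqueFinset_iff, Set.mem_ofPred_eq,
        mem_insert_self, and_true]
      constructor
      · rw [Finset.coe_insert, SimpleGraph.isClique_insert]
        constructor
        · intro x hx y hy hxy
          rw [Finset.mem_coe, Finset.mem_erase] at hx hy
          exact (hadj x y hx.1 hy.1).1 (hs.isClique hx.2 hy.2 hxy)
        · intro y hy _
          rw [Finset.mem_coe, Finset.mem_erase] at hy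
          exact (hadj' y (ne_of_mem_of_not_mem hy.2 hu) hy.1).1 (hs.isClique hv hy.2 hy.1.symm)
      · rw [Finset.card_insert_of_notMem hu', Finset.card_erase_of_mem hv, hs.card_eq]
    · simp only [coe_filter, mem_filter, Set.mem_ofPred_eq] at hs ht
      have e₁ : ∀ s : Finset V, v ∈ s → u ∉ s → insert v ((insert u (s.erase v)).erase u) = s := by
        intro s hv hu
        rw [Finset.erase_insert (fun h => hu (Finset.mem_of_mem_erase h)), Finset.insert_erase hv]
      rw [← e₁ s hs.1.2 hs.2, ← e₁ t ht.1.2 ht.2]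
      exact congrArg (fun r => insert v (Finset.erase r u)) hst
  rw [heq, ← Finset.card_filter_add_card_filter_not (s := {s ∈ G'.cliqueFinset 4 | v ∈ s})
    (fun s => u ∈ s)] at hle
  have h₃ : #(cliquesAt G v) = #{s ∈ G.cliqueFinset 4 | v ∈ s} := rfl
  omega

/-- In an extremal graph, every vertex has few non-adjacent triples in the complement. -/
theorem sum_indepInd_le_of_minimal {G : SimpleGraph V} (hG : G.IndepSetFree 3)
    (hmin : ∀ G' : SimpleGraph V, G'.IndepSetFree 3 → cliqueCount G 4 ≤ cliqueCount G' 4)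
    (v : V) : Fintype.card V * ∑ x, ∑ y, ∑ z, indepInd (complAdj G) v x y z ≤
      24 * cliqueCount G 4 + 12 * (Fintype.card V : ℤ) ^ 3 := by
  have h₁ : ∀ u, ∑ x, ∑ y, ∑ z, indepInd (complAdj G) v x y z ≤
      6 * (cliquesAt G u).card + 12 * (Fintype.card V : ℤ) ^ 2 := by
    intro u
    have h := card_cliquesAt_le_add hG hmin u v
    zify at h
    linarith [sum_indepInd_le G v]
  have h₂ := Finset.sum_le_sum fun u (_ : u ∈ Finset.univ) => h₁ u
  rw [Finset.sum_add_distrib, ← Finset.mul_sum] at h₂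
  simp only [Finset.sum_const, Finset.card_univ, nsmul_eq_mul] at h₂
  have h₃ : ∑ u, ((cliquesAt G u).card : ℤ) = 4 * cliqueCount G 4 := by
    exact_mod_cast sum_card_cliquesAt G
  rw [h₃] at h₂
  linarith

theorem sum_indepInd_le_cliqueCount (G : SimpleGraph V) :
    ∑ a, ∑ b, ∑ c, ∑ d, indepInd (complAdj G) a b c d ≤
      24 * cliqueCount G 4 + 6 * (Fintype.card V : ℤ) ^ 3 := by
  have h₂ := Finset.sum_le_sum fun u (_ : u ∈ Finset.univ) => sum_indepInd_le G u
  rw [Finset.sum_add_distrib, ← Finset.mul_sum] at h₂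
  simp only [Finset.sum_const, Finset.card_univ, nsmul_eq_mul] at h₂
  have h₃ : ∑ u, ((cliquesAt G u).card : ℤ) = 4 * cliqueCount G 4 := by
    exact_mod_cast sum_card_cliquesAt G
  rw [h₃] at h₂
  linarith

end Cliques

/-! ### The optimal part sizes -/

/-- The number of four-cliques in the blow-up of the five-cycle with part sizes `a`. -/
def blowUpCount (a : Fin 5 → ℕ) : ℤ :=
  ∑ i, (((a i + a (i + 1)).choose 4 : ℤ) - ((a i).choose 4 : ℤ))

theorem twentyFour_mul_choose_four (m : ℕ) :
    (24 * (m.choose 4 : ℤ)) = m * (m - 1) * (m - 2) * (m - 3) := by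
  have h₂ : ∀ m : ℕ, (2 * (m.choose 2 : ℤ)) = m * (m - 1) := by
    intro m
    induction m with
    | zero => simp
    | succ m ih =>
      rw [Nat.choose_succ_succ' m 1, Nat.choose_one_right]
      push_cast
      linear_combination ih
  have h₃ : ∀ m : ℕ, (6 * (m.choose 3 : ℤ)) = m * (m - 1) * (m - 2) := by
    intro m
    induction m with
    | zero => simp
    | succ m ih =>
      rw [Nat.choose_succ_succ' m 2]
      push_cast
      linear_combination ih + 3 * h₂ m
  induction m with
  | zero => simp
  | succ m ih =>
    rw [Nat.choose_succ_succ' m 3]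
    push_cast
    linear_combination ih + 4 * h₃ m

/-- The leading quadratic form governing the number of four-cliques in terms of the deviations of
the part sizes. -/
def sizeForm (y : Fin 5 → ℤ) : ℤ := 4 * ∑ i, (y i + y (i + 1)) ^ 2 - ∑ i, y i ^ 2

/-- The deviations of `partSizes n` from `n / 5`, for `r = n % 5`. -/
def sizeDev (r : ℕ) : Fin 5 → ℤ :=
  match r with
  | 0 => ![0, 0, 0, 0, 0]
  | 1 => ![0, 0, 1, -1, 1]
  | 2 => ![0, 0, 1, 0, 1]
  | 3 => ![1, 1, 0, 1, 0]
  | _ => ![1, 1, 0, 2, 0]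

/-- For a fixed sum s the form is least at the constant vector, with value 3s², and its excess over
that controls every coordinate. -/
theorem sq_sub_sum_le_sizeForm (y : Fin 5 → ℤ) (j : Fin 5) :
    (5 * y j - ∑ i, y i) ^ 2 ≤ 20 * (sizeForm y - 3 * (∑ i, y i) ^ 2) := by
  have core : ∀ a b c d e : ℤ, (5 * a - (a + b + c + d + e)) ^ 2 ≤
      20 * (4 * ((a + b) ^ 2 + (b + c) ^ 2 + (c + d) ^ 2 + (d + e) ^ 2 + (e + a) ^ 2)
        - (a ^ 2 + b ^ 2 + c ^ 2 + d ^ 2 + e ^ 2) - 3 * (a + b + c + d + e) ^ 2) := by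
    intro a b c d e
    linarith [sq_nonneg (10 * (b + e) + 15 * a - 7 * (a + b + c + d + e)),
      sq_nonneg (3 * (c - d) + 4 * (b - e)), sq_nonneg (b - e)]
  have h := core (y j) (y (j + 1)) (y (j + 2)) (y (j + 3)) (y (j + 4))
  have e₁ : ∀ f : Fin 5 → ℤ, ∑ i, f i = f j + f (j + 1) + f (j + 2) + f (j + 3) + f (j + 4) := by
    intro f
    rw [← Equiv.sum_comp (Equiv.addLeft j)]
    simp [Fin.sum_univ_five]
  rw [sizeForm, e₁ y, e₁ fun i => (y i + y (i + 1)) ^ 2, e₁ fun i => y i ^ 2]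
  simp only [add_assoc, Fin.reduceAdd, add_zero] at h ⊢
  exact h

theorem sum_sq_le_sizeForm (y : Fin 5 → ℤ) : ∑ i, y i ^ 2 ≤ 4 * sizeForm y := by
  have h := fun j => sq_sub_sum_le_sizeForm y j
  have h' := Finset.sum_le_sum fun j (_ : j ∈ Finset.univ) => h j
  simp only [Finset.sum_const, Finset.card_univ, Fintype.card_fin] at h'
  have e₁ : ∑ j, (5 * y j - ∑ i, y i) ^ 2 = 25 * ∑ j, y j ^ 2 - 5 * (∑ i, y i) ^ 2 := by
    simp only [Fin.sum_univ_five]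
    ring
  rw [e₁] at h'
  simp only [nsmul_eq_mul, Nat.cast_ofNat] at h'
  nlinarith [sq_nonneg (∑ i, y i)]

/-- The excess over 3r² is at most 2, so |5 y_j - r| < 7 and every y_j lies in {-1, 0, 1, 2}. A
finite search then leaves the rotations and reflections of `sizeDev r`. -/
theorem sizeForm_minimizer {y : Fin 5 → ℤ} {r : ℕ} (hr : r < 5) (hs : ∑ i, y i = r)
    (hy : sizeForm y ≤ sizeForm (sizeDev r)) :
    ∃ c, (∀ i, y i = sizeDev r (i + c)) ∨ ∀ i, y i = sizeDev r (c - i) := by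
  have hQ : sizeForm (sizeDev r) ≤ 3 * (r : ℤ) ^ 2 + 2 := by
    interval_cases r <;> decide
  have hb : ∀ j, -1 ≤ y j ∧ y j ≤ 2 := by
    intro j
    have h := sq_sub_sum_le_sizeForm y j
    rw [hs] at h
    have h₁ : (5 * y j - r) ^ 2 < 7 ^ 2 := by linarith
    have h₂ := abs_lt_of_sq_lt_sq' h₁ (by norm_num)
    omega
  have key : ∀ r : Fin 5, ∀ z₀ z₁ z₂ z₃ z₄ : Fin 4,
      ((z₀ : ℤ) - 1) + ((z₁ : ℤ) - 1) + ((z₂ : ℤ) - 1) + ((z₃ : ℤ) - 1) + ((z₄ : ℤ) - 1) = r →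
      sizeForm ![(z₀ : ℤ) - 1, (z₁ : ℤ) - 1, (z₂ : ℤ) - 1, (z₃ : ℤ) - 1, (z₄ : ℤ) - 1] ≤
        sizeForm (sizeDev r) →
      ∃ c, (∀ i, (![(z₀ : ℤ) - 1, (z₁ : ℤ) - 1, (z₂ : ℤ) - 1, (z₃ : ℤ) - 1, (z₄ : ℤ) - 1] :
        Fin 5 → ℤ) i = sizeDev r (i + c)) ∨
        ∀ i, (![(z₀ : ℤ) - 1, (z₁ : ℤ) - 1, (z₂ : ℤ) - 1, (z₃ : ℤ) - 1, (z₄ : ℤ) - 1] :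
        Fin 5 → ℤ) i = sizeDev r (c - i) := by
    decide +kernel
  have hz : ∀ j, ∃ z : Fin 4, y j = (z : ℤ) - 1 := fun j =>
    ⟨⟨(y j + 1).toNat, by have := hb j; omega⟩, by have := hb j; simp; omega⟩
  choose z hz using hz
  have hyz : y = ![(z 0 : ℤ) - 1, (z 1 : ℤ) - 1, (z 2 : ℤ) - 1, (z 3 : ℤ) - 1, (z 4 : ℤ) - 1] := by
    funext i
    fin_cases i <;> simp [hz]
  have h := key ⟨r, hr⟩ (z 0) (z 1) (z 2) (z 3) (z 4)
  rw [← hyz] at h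
  refine h ?_ hy
  rw [Fin.sum_univ_five] at hs
  simp only [hz] at hs
  exact hs

/-- The part of `24 * blowUpCount (k + y)` that depends on `y` beyond its sum. -/
def sizeError (k : ℝ) (y : Fin 5 → ℝ) : ℝ :=
  ∑ i, ((-36 * k + 11) * (y i + y (i + 1)) ^ 2 + (8 * k - 6) * (y i + y (i + 1)) ^ 3
    + (y i + y (i + 1)) ^ 4 - ((-18 * k + 11) * y i ^ 2 + (4 * k - 6) * y i ^ 3 + y i ^ 4))

/-- With deviations at most k/10⁴, the lower-order quadratic, cubic and quartic terms are all small
multiples of k² y². -/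
theorem abs_sizeError_le {k : ℝ} (hk : 10 ^ 6 ≤ k) {y : Fin 5 → ℝ}
    (hy : ∀ i, |y i| ≤ k / 10 ^ 4) : |sizeError k y| ≤ k ^ 2 / 100 * ∑ i, y i ^ 2 := by
  have h₁ : ∀ x : ℝ, |x| ≤ k / 5000 →
      |(-36 * k + 11) * x ^ 2 + (8 * k - 6) * x ^ 3 + x ^ 4| ≤ k ^ 2 * 17 / 10000 * x ^ 2 := by
    intro x hx
    have e₁ : (-36 * k + 11) * x ^ 2 + (8 * k - 6) * x ^ 3 + x ^ 4 =
      ((-36 * k + 11) + (8 * k - 6) * x + x ^ 2) * x ^ 2 := by ring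
    rw [e₁, abs_mul, abs_of_nonneg (sq_nonneg x)]
    refine mul_le_mul_of_nonneg_right ?_ (sq_nonneg x)
    have hx' := abs_le.1 hx
    have hx₂ : x ^ 2 ≤ (k / 5000) ^ 2 := sq_le_sq' (by linarith) hx'.2
    have h₃ : (8 * k - 6) * x ≤ (8 * k - 6) * (k / 5000) :=
      mul_le_mul_of_nonneg_left hx'.2 (by linarith)
    have h₄ : (8 * k - 6) * (-(k / 5000)) ≤ (8 * k - 6) * x :=
      mul_le_mul_of_nonneg_left hx'.1 (by linarith)
    rw [abs_le]
    constructor <;> nlinarith [sq_nonneg x]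
  have h₂ : ∀ x : ℝ, |x| ≤ k / 10 ^ 4 →
      |(-18 * k + 11) * x ^ 2 + (4 * k - 6) * x ^ 3 + x ^ 4| ≤ k ^ 2 * 17 / 10000 * x ^ 2 := by
    intro x hx
    have e₁ : (-18 * k + 11) * x ^ 2 + (4 * k - 6) * x ^ 3 + x ^ 4 =
      ((-18 * k + 11) + (4 * k - 6) * x + x ^ 2) * x ^ 2 := by ring
    rw [e₁, abs_mul, abs_of_nonneg (sq_nonneg x)]
    refine mul_le_mul_of_nonneg_right ?_ (sq_nonneg x)
    have hx' := abs_le.1 hx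
    have hx₂ : x ^ 2 ≤ (k / 10 ^ 4) ^ 2 := sq_le_sq' (by linarith) hx'.2
    have h₃ : (4 * k - 6) * x ≤ (4 * k - 6) * (k / 10 ^ 4) :=
      mul_le_mul_of_nonneg_left hx'.2 (by linarith)
    have h₄ : (4 * k - 6) * (-(k / 10 ^ 4)) ≤ (4 * k - 6) * x :=
      mul_le_mul_of_nonneg_left hx'.1 (by linarith)
    rw [abs_le]
    constructor <;> nlinarith [sq_nonneg x]
  have h₃ : ∀ i, |(-36 * k + 11) * (y i + y (i + 1)) ^ 2 + (8 * k - 6) * (y i + y (i + 1)) ^ 3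
      + (y i + y (i + 1)) ^ 4 - ((-18 * k + 11) * y i ^ 2 + (4 * k - 6) * y i ^ 3 + y i ^ 4)| ≤
      k ^ 2 * 17 / 10000 * (3 * y i ^ 2 + 2 * y (i + 1) ^ 2) := by
    intro i
    have a₁ := h₁ (y i + y (i + 1)) ((abs_add_le _ _).trans (by linarith [hy i, hy (i + 1)]))
    have a₂ := h₂ (y i) (hy i)
    refine (abs_sub _ _).trans ?_
    have hk₂ : 0 ≤ k ^ 2 * 17 / 10000 := by positivity
    nlinarith [mul_nonneg hk₂ (sq_nonneg (y i - y (i + 1)))]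
  refine (Finset.abs_sum_le_sum_abs _ _).trans ((Finset.sum_le_sum fun i _ => h₃ i).trans ?_)
  have hshift : ∑ i, y (i + 1) ^ 2 = ∑ i, y i ^ 2 :=
    Equiv.sum_comp (Equiv.addRight (1 : Fin 5)) (fun i => y i ^ 2)
  rw [← Finset.mul_sum, Finset.sum_add_distrib, ← Finset.mul_sum, ← Finset.mul_sum, hshift]
  have hS : 0 ≤ ∑ i, y i ^ 2 := Finset.sum_nonneg fun i _ => sq_nonneg _
  have hkS : 0 ≤ k ^ 2 * ∑ i, y i ^ 2 := mul_nonneg (sq_nonneg k) hS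
  linarith

theorem blowUpCount_eq {a : Fin 5 → ℕ} {k : ℕ} {y : Fin 5 → ℤ} (h : ∀ i, (a i : ℤ) = k + y i) :
    (24 * blowUpCount a : ℝ) = 5 * (2 * k * (2 * k - 1) * (2 * k - 2) * (2 * k - 3)
      - k * (k - 1) * (k - 2) * (k - 3))
      + (2 * (32 * k ^ 3 - 72 * k ^ 2 + 44 * k - 6) - (4 * k ^ 3 - 18 * k ^ 2 + 22 * k - 6))
        * ((∑ i, y i : ℤ) : ℝ)
      + 6 * k ^ 2 * sizeForm y + sizeError k (fun i => y i) := by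
  have h' : ∀ i, (a i : ℝ) = k + y i := fun i => by exact_mod_cast h i
  have hc : ∀ m : ℕ, (24 * (m.choose 4 : ℝ)) = m * (m - 1) * (m - 2) * (m - 3) := fun m => by
    exact_mod_cast twentyFour_mul_choose_four m
  have h₁ : (24 * blowUpCount a : ℝ) = ∑ i, ((24 * ((a i + a (i + 1)).choose 4 : ℝ))
      - 24 * ((a i).choose 4 : ℝ)) := by
    unfold blowUpCount
    push_cast
    rw [Finset.mul_sum]
    exact Finset.sum_congr rfl fun i _ => mul_sub _ _ _
  rw [h₁]
  simp only [hc, Nat.cast_add, h', sizeError, sizeForm, Fin.sum_univ_five, Fin.reduceAdd]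
  push_cast
  ring

/-- The bound on n makes the truncated `k - 1` agree with integer subtraction. -/
theorem partSizes_eq {n : ℕ} (hn : 5 ≤ n) (i : Fin 5) :
    (partSizes n i : ℤ) = (n / 5 : ℕ) + sizeDev (n % 5) i := by
  have h : n % 5 < 5 := Nat.mod_lt _ (by norm_num)
  unfold partSizes sizeDev
  generalize n % 5 = r at h
  interval_cases r <;> fin_cases i <;> (simp; try omega)

theorem sum_sizeDev {r : ℕ} (hr : r < 5) : ∑ i, sizeDev r i = r := by
  interval_cases r <;> decide

theorem sum_partSizes {n : ℕ} (hn : 5 ≤ n) : ∑ i, partSizes n i = n := by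
  have h : ∑ i, (partSizes n i : ℤ) = n := by
    simp only [partSizes_eq hn, Finset.sum_add_distrib, sum_sizeDev (Nat.mod_lt n (by norm_num)),
      Finset.sum_const, Finset.card_univ, Fintype.card_fin, nsmul_eq_mul]
    omega
  exact_mod_cast h

theorem abs_sizeDev_le (r : ℕ) (i : Fin 5) : |sizeDev r i| ≤ 2 := by
  have h : ∀ r < 5, ∀ i, |sizeDev r i| ≤ 2 := by decide
  rcases lt_or_ge r 5 with hr | hr
  · exact h r hr i
  · have : sizeDev r = sizeDev 4 := by
      match r, hr with
      | (s + 5), _ => rfl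
    rw [this]
    exact h 4 (by norm_num) i

/-- The sum of the deviations is fixed, so only 6k² `sizeForm` and the error vary. `sizeForm` is an
integer: a non-minimal value costs at least 6k², more than the errors can recover, since these are
controlled by `sizeForm` itself through `sum_sq_le_sizeForm`. -/
theorem eq_partSizes_of_blowUpCount_le {n : ℕ} (hn : 10 ^ 7 ≤ n) {a : Fin 5 → ℕ}
    (hs : ∑ i, a i = n) (ha : ∀ i, |(a i : ℝ) - n / 5| ≤ 5 / 10 ^ 6 * n)
    (hle : blowUpCount a ≤ blowUpCount (partSizes n)) :
    ∃ c, (∀ i, a i = partSizes n (i + c)) ∨ ∀ i, a i = partSizes n (c - i) := by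
  have hn5 : 5 ≤ n := le_trans (by norm_num) hn
  have hr : n % 5 < 5 := Nat.mod_lt _ (by norm_num)
  set k := n / 5 with hk
  set r := n % 5 with hr'
  have hnk : n = 5 * k + r := by omega
  set y : Fin 5 → ℤ := fun i => (a i : ℤ) - k with hy
  have hay : ∀ i, (a i : ℤ) = k + y i := fun i => by simp [hy]
  have hsy : ∑ i, y i = r := by
    have h : ∑ i, (a i : ℤ) = n := by exact_mod_cast hs
    simp only [hy, Finset.sum_sub_distrib, h, Finset.sum_const, Finset.card_univ, Fintype.card_fin,
      nsmul_eq_mul]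
    push_cast [hnk]
    ring
  have hp : ∀ i, (partSizes n i : ℤ) = k + sizeDev r i := partSizes_eq hn5
  have hkR : (10 : ℝ) ^ 6 ≤ k := by
    have : 10 ^ 6 ≤ k := by omega
    exact_mod_cast this
  have hkR' : (1000000 : ℝ) ≤ k := le_trans (by norm_num) hkR
  have hrR : (r : ℝ) ≤ 4 := by
    have : r ≤ 4 := by omega
    exact_mod_cast this
  have hr0 : (0 : ℝ) ≤ r := Nat.cast_nonneg _
  have hnR : (n : ℝ) = 5 * k + r := by exact_mod_cast hnk
  have hyk : ∀ i, |(y i : ℝ)| ≤ k / 10 ^ 4 := by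
    intro i
    have h := abs_le.1 (ha i)
    have h₂ : (a i : ℝ) = k + y i := by exact_mod_cast hay i
    rw [hnR, h₂] at h
    norm_num at h
    rw [abs_le]
    norm_num
    constructor <;> linarith [h.1, h.2]
  have hdk : ∀ i, |(sizeDev r i : ℝ)| ≤ k / 10 ^ 4 := by
    intro i
    have h : |(sizeDev r i : ℝ)| ≤ 2 := by exact_mod_cast abs_sizeDev_le r i
    norm_num
    linarith
  have ea := abs_le.1 (abs_sizeError_le hkR hyk)
  have ep := abs_le.1 (abs_sizeError_le hkR hdk)
  have hle' : (24 * blowUpCount a : ℝ) ≤ 24 * blowUpCount (partSizes n) := by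
    exact_mod_cast mul_le_mul_of_nonneg_left hle (by norm_num : (0 : ℤ) ≤ 24)
  rw [blowUpCount_eq hay, blowUpCount_eq hp, hsy, sum_sizeDev hr] at hle'
  have hSy : (∑ i, (y i : ℝ) ^ 2) ≤ 4 * sizeForm y := by exact_mod_cast sum_sq_le_sizeForm y
  have hSp : (∑ i, (sizeDev r i : ℝ) ^ 2) ≤ 6 := by
    have h : ∑ i, sizeDev r i ^ 2 ≤ 6 := by interval_cases r <;> decide
    exact_mod_cast h
  have hQp : (sizeForm (sizeDev r) : ℝ) ≤ 50 := by
    have h : sizeForm (sizeDev r) ≤ 50 := by interval_cases r <;> decide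
    exact_mod_cast h
  have hQ : sizeForm y ≤ sizeForm (sizeDev r) := by
    by_contra hcon
    have hcon' : (sizeForm (sizeDev r) : ℝ) + 1 ≤ sizeForm y := by
      exact_mod_cast not_le.1 hcon
    have hk2 : (0 : ℝ) < (k : ℝ) ^ 2 := by positivity
    have h₁ : (k : ℝ) ^ 2 * (6 * sizeForm y - 1 / 100 * ∑ i, (y i : ℝ) ^ 2) ≤
        (k : ℝ) ^ 2 * (6 * sizeForm (sizeDev r) + 1 / 100 * ∑ i, (sizeDev r i : ℝ) ^ 2) := by
      linarith [ea.1, ep.2]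
    have h₂ := le_of_mul_le_mul_left h₁ hk2
    linarith
  obtain ⟨c, hc | hc⟩ := sizeForm_minimizer hr hsy hQ
  · refine ⟨c, Or.inl fun i => ?_⟩
    have h₁ := hay i
    rw [hc, ← hp] at h₁
    exact_mod_cast h₁
  · refine ⟨c, Or.inr fun i => ?_⟩
    have h₁ := hay i
    rw [hc, ← hp] at h₁
    exact_mod_cast h₁

theorem blowUpCount_partSizes_le {n : ℕ} (hn : 10 ^ 7 ≤ n) :
    (24 * blowUpCount (partSizes n) : ℝ) ≤ 3 / 25 * (n : ℝ) ^ 4 + 2 * (n : ℝ) ^ 3 := by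
  have hn5 : 5 ≤ n := le_trans (by norm_num) hn
  have hr : n % 5 < 5 := Nat.mod_lt _ (by norm_num)
  have hp : ∀ i, (partSizes n i : ℤ) = (n / 5 : ℕ) + sizeDev (n % 5) i := partSizes_eq hn5
  rw [blowUpCount_eq hp, sum_sizeDev hr]
  set k := n / 5 with hk
  set r := n % 5 with hr'
  have hkR : (10 : ℝ) ^ 6 ≤ k := by
    have : 10 ^ 6 ≤ k := by omega
    exact_mod_cast this
  have hkR' : (1000000 : ℝ) ≤ k := le_trans (by norm_num) hkR
  have hrR : (r : ℝ) ≤ 4 := by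
    have : r ≤ 4 := by omega
    exact_mod_cast this
  have hr0 : (0 : ℝ) ≤ r := Nat.cast_nonneg _
  have hkn : (5 * k : ℝ) ≤ n := by
    have : 5 * k ≤ n := by omega
    exact_mod_cast this
  have hdk : ∀ i, |(sizeDev r i : ℝ)| ≤ k / 10 ^ 4 := by
    intro i
    have h : |(sizeDev r i : ℝ)| ≤ 2 := by exact_mod_cast abs_sizeDev_le r i
    norm_num
    linarith
  have ep := (abs_le.1 (abs_sizeError_le hkR hdk)).2
  have hSp : (∑ i, (sizeDev r i : ℝ) ^ 2) ≤ 6 := by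
    have h : ∑ i, sizeDev r i ^ 2 ≤ 6 := by interval_cases r <;> decide
    exact_mod_cast h
  have hQp : (sizeForm (sizeDev r) : ℝ) ≤ 50 := by
    have h : sizeForm (sizeDev r) ≤ 50 := by interval_cases r <;> decide
    exact_mod_cast h
  have hk0 : (0 : ℝ) < k := by linarith
  have hk2 : (0 : ℝ) < (k : ℝ) ^ 2 := by positivity
  have n4 : (5 * k : ℝ) ^ 4 ≤ (n : ℝ) ^ 4 := pow_le_pow_left₀ (by positivity) hkn 4
  have n3 : (5 * k : ℝ) ^ 3 ≤ (n : ℝ) ^ 3 := pow_le_pow_left₀ (by positivity) hkn 3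
  have k3 : (1000000 : ℝ) * (k : ℝ) ^ 2 ≤ (k : ℝ) ^ 3 := by nlinarith
  have k2 : (1000000 : ℝ) * k ≤ (k : ℝ) ^ 2 := by nlinarith
  have b₁ : (k : ℝ) ^ 2 / 100 * (∑ i, (sizeDev r i : ℝ) ^ 2) ≤ (k : ℝ) ^ 2 / 100 * 6 :=
    mul_le_mul_of_nonneg_left hSp (by positivity)
  have b₂ : 6 * (k : ℝ) ^ 2 * sizeForm (sizeDev r) ≤ 6 * (k : ℝ) ^ 2 * 50 :=
    mul_le_mul_of_nonneg_left hQp (by positivity)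
  -- The remainder r ≤ 4 contributes at most 240k³, which fits in 2n³ ≥ 250k³; the leading term 75k⁴
  -- equals 3(5k)⁴/25.
  have b₃ : (2 * (32 * (k : ℝ) ^ 3 - 72 * k ^ 2 + 44 * k - 6)
      - (4 * k ^ 3 - 18 * k ^ 2 + 22 * k - 6)) * ((r : ℤ) : ℝ) ≤ (60 * (k : ℝ) ^ 3) * 4 := by
    rw [Int.cast_natCast]
    exact mul_le_mul (by linarith) hrR hr0 (by positivity)
  have b₄ : 5 * (2 * (k : ℝ) * (2 * k - 1) * (2 * k - 2) * (2 * k - 3)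
      - k * (k - 1) * (k - 2) * (k - 3)) ≤ 75 * (k : ℝ) ^ 4 := by
    have : 5 * (2 * (k : ℝ) * (2 * k - 1) * (2 * k - 2) * (2 * k - 3)
      - k * (k - 1) * (k - 2) * (k - 3)) =
      75 * (k : ℝ) ^ 4 - 210 * k ^ 3 + 165 * k ^ 2 - 30 * k := by ring
    rw [this]
    linarith
  ring_nf at n4 n3 b₁ b₂ b₃ b₄ ep ⊢
  linarith

/-! ### Blow-ups of the five-cycle along a map -/

section CycleBlowUp

variable {V : Type*}

/-- The blow-up of the five-cycle in which the part of `x` is `ψ x`. -/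
def cycleBlowUp (ψ : V → Fin 5) : SimpleGraph V where
  Adj x y := x ≠ y ∧ (ψ x = ψ y ∨ (SimpleGraph.cycleGraph 5).Adj (ψ x) (ψ y))
  symm := ⟨fun _ _ h => ⟨h.1.symm, h.2.imp Eq.symm SimpleGraph.Adj.symm⟩⟩
  loopless := ⟨fun _ h => h.1 rfl⟩

theorem cycleGraph_five_adj_iff :
    ∀ i j : Fin 5, (SimpleGraph.cycleGraph 5).Adj i j ↔ j = i + 1 ∨ i = j + 1 := by
  decide

theorem cycleBlowUp_adj {ψ : V → Fin 5} {x y : V} :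
    (cycleBlowUp ψ).Adj x y ↔ x ≠ y ∧ (ψ x = ψ y ∨ ψ y = ψ x + 1 ∨ ψ x = ψ y + 1) := by
  rw [← cycleGraph_five_adj_iff]
  rfl

theorem indepSetFree_cycleBlowUp (ψ : V → Fin 5) : (cycleBlowUp ψ).IndepSetFree 3 := by
  classical
  rw [← SimpleGraph.cliqueFree_compl]
  intro s hs
  obtain ⟨x, y, z, hxy, hxz, hyz, -⟩ := SimpleGraph.is3Clique_iff.1 hs
  have h : ∀ x y, (cycleBlowUp ψ)ᶜ.Adj x y →
      ¬(ψ x = ψ y ∨ ψ y = ψ x + 1 ∨ ψ x = ψ y + 1) := by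
    intro x y hxy h
    rw [SimpleGraph.compl_adj, cycleBlowUp_adj] at hxy
    exact hxy.2 ⟨hxy.1, h⟩
  have key : ∀ i j k : Fin 5, ¬(i = j ∨ j = i + 1 ∨ i = j + 1) →
      ¬(i = k ∨ k = i + 1 ∨ i = k + 1) → ¬(j = k ∨ k = j + 1 ∨ j = k + 1) → False := by decide
  exact key _ _ _ (h _ _ hxy) (h _ _ hxz) (h _ _ hyz)

/-- The second condition selects one i per clique: a clique inside a single part j is charged to i =
j - 1. This is why `blowUpCount` subtracts the cliques inside part i. -/
theorem exists_part_of_clique {s : Finset (Fin 5)} (hs : s.Nonempty)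
    (h : ∀ i ∈ s, ∀ j ∈ s, i = j ∨ j = i + 1 ∨ i = j + 1) :
    ∃ i, s ⊆ {i, i + 1} ∧ ¬ s ⊆ {i} := by
  revert s
  decide

open Finset in
open scoped Classical in
theorem cliqueCount_cycleBlowUp [Fintype V] (ψ : V → Fin 5) :
    (cliqueCount (cycleBlowUp ψ) 4 : ℤ) = blowUpCount fun i => #{x | ψ x = i} := by
  set F : Fin 5 → Finset V := fun i => {x | ψ x = i} with hF
  have hmem : ∀ i x, x ∈ F i ↔ ψ x = i := fun i x => by simp [hF]
  have hdisj : ∀ i, Disjoint (F i) (F (i + 1)) := by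
    intro i
    rw [Finset.disjoint_left]
    intro x h₁ h₂
    rw [hmem] at h₁ h₂
    rw [h₁] at h₂
    exact (by decide : ∀ i : Fin 5, i ≠ i + 1) i h₂
  have hunion : (cycleBlowUp ψ).cliqueFinset 4 =
      univ.biUnion fun i => powersetCard 4 (F i ∪ F (i + 1)) \ powersetCard 4 (F i) := by
    ext s
    simp only [SimpleGraph.mem_cliqueFinset_iff, SimpleGraph.isNClique_iff, mem_biUnion, mem_univ,
      true_and, mem_sdiff, mem_powersetCard]
    constructor
    · rintro ⟨hs, h4⟩
      obtain ⟨i, hi, hi'⟩ := exists_part_of_clique (s := s.image ψ)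
        (Finset.Nonempty.image (Finset.card_pos.1 (by omega)) ψ) (by
          intro i hi j hj
          obtain ⟨x, hx, rfl⟩ := Finset.mem_image.1 hi
          obtain ⟨y, hy, rfl⟩ := Finset.mem_image.1 hj
          by_cases hxy : x = y
          · exact Or.inl (congrArg ψ hxy)
          · exact (cycleBlowUp_adj.1 (hs hx hy hxy)).2)
      refine ⟨i, ⟨fun x hx => ?_, h4⟩, fun h => hi' fun j hj => ?_⟩
      · have := hi (Finset.mem_image_of_mem ψ hx)
        rw [mem_insert, mem_singleton] at this
        rwa [mem_union, hmem, hmem]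
      · obtain ⟨x, hx, rfl⟩ := Finset.mem_image.1 hj
        exact Finset.mem_singleton.2 ((hmem _ _).1 (h.1 hx))
    · rintro ⟨i, ⟨hs, h4⟩, -⟩
      refine ⟨fun x hx y hy hxy => cycleBlowUp_adj.2 ⟨hxy, ?_⟩, h4⟩
      have h₁ := hs hx
      have h₂ := hs hy
      rw [mem_union, hmem, hmem] at h₁ h₂
      rcases h₁ with h₁ | h₁ <;> rcases h₂ with h₂ | h₂ <;> rw [h₁, h₂] <;> simp
  have hpd : ∀ i ∈ (univ : Finset (Fin 5)), ∀ j ∈ (univ : Finset (Fin 5)), i ≠ j →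
      Disjoint (powersetCard 4 (F i ∪ F (i + 1)) \ powersetCard 4 (F i))
        (powersetCard 4 (F j ∪ F (j + 1)) \ powersetCard 4 (F j)) := by
    intro i _ j _ hij
    rw [Finset.disjoint_left]
    intro s h₁ h₂
    simp only [mem_sdiff, mem_powersetCard, not_and] at h₁ h₂
    have key : ∀ i j : Fin 5, i ≠ j → ∀ t : Finset (Fin 5), t ⊆ {i, i + 1} → t ⊆ {j, j + 1} →
        t ⊆ {i} ∨ t ⊆ {j} := by decide
    have himg : ∀ i, s ⊆ F i ∪ F (i + 1) → s.image ψ ⊆ {i, i + 1} := by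
      intro i h k hk
      obtain ⟨x, hx, rfl⟩ := Finset.mem_image.1 hk
      have := h hx
      rw [mem_union, hmem, hmem] at this
      simpa using this
    have himg' : ∀ i, s.image ψ ⊆ {i} → s ⊆ F i := by
      intro i h x hx
      exact (hmem _ _).2 (Finset.mem_singleton.1 (h (Finset.mem_image_of_mem ψ hx)))
    rcases key i j hij _ (himg i h₁.1.1) (himg j h₂.1.1) with h | h
    · exact h₁.2 (himg' i h) h₁.1.2
    · exact h₂.2 (himg' j h) h₂.1.2
  rw [cliqueCount_eq_card, hunion, Finset.card_biUnion hpd, blowUpCount]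
  push_cast
  refine Finset.sum_congr rfl fun i _ => ?_
  rw [Finset.card_sdiff_of_subset (Finset.powersetCard_mono Finset.subset_union_left),
    Finset.card_powersetCard, Finset.card_powersetCard, Finset.card_union_of_disjoint (hdisj i),
    Nat.cast_sub (Nat.choose_le_choose 4 (Nat.le_add_right _ _))]

open Finset in
open scoped Classical in
theorem nonempty_iso_blowUp [Fintype V] {ψ : V → Fin 5} {m : Fin 5 → ℕ}
    (hm : ∀ i, #{x | ψ x = i} = m i) :
    Nonempty (cycleBlowUp ψ ≃g blowUp (SimpleGraph.cycleGraph 5) m) := by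
  have h : ∀ i, Nonempty ({x // ψ x = i} ≃ Fin (m i)) := fun i =>
    ⟨Fintype.equivFinOfCardEq ((Fintype.card_subtype _).trans (hm i))⟩
  refine ⟨⟨(Equiv.sigmaFiberEquiv ψ).symm.trans (Equiv.sigmaCongrRight fun i => (h i).some), ?_⟩⟩
  intro x y
  set f := (Equiv.sigmaFiberEquiv ψ).symm.trans (Equiv.sigmaCongrRight fun i => (h i).some)
  change (f x ≠ f y ∧ (ψ x = ψ y ∨ (SimpleGraph.cycleGraph 5).Adj (ψ x) (ψ y))) ↔
    (x ≠ y ∧ (ψ x = ψ y ∨ (SimpleGraph.cycleGraph 5).Adj (ψ x) (ψ y)))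
  rw [f.injective.ne_iff]

open Finset in
open scoped Classical in
-- An extra edge would join two non-adjacent parts. These have a common neighbouring part, and two
-- vertices of it complete the edge to a K₄ absent from the blow-up.
theorem eq_cycleBlowUp_of_cliqueCount_le [Fintype V] {G : SimpleGraph V} {ψ : V → Fin 5}
    (hle : cycleBlowUp ψ ≤ G) (hcard : ∀ i, 2 ≤ #{x | ψ x = i})
    (hcount : cliqueCount G 4 ≤ cliqueCount (cycleBlowUp ψ) 4) : G = cycleBlowUp ψ := by
  rw [cliqueCount_eq_card, cliqueCount_eq_card] at hcount
  have heq := Finset.eq_of_subset_of_card_le (SimpleGraph.cliqueFinset_mono G hle) hcount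
  refine le_antisymm (fun x y hxy => ?_) hle
  by_contra hcon
  have key : ∀ i j : Fin 5, ¬(i = j ∨ j = i + 1 ∨ i = j + 1) →
      ∃ k, (i ≠ k ∧ (k = i + 1 ∨ i = k + 1)) ∧ (j ≠ k ∧ (k = j + 1 ∨ j = k + 1)) := by decide
  rw [cycleBlowUp_adj] at hcon
  obtain ⟨k, ⟨k₁, k₂⟩, k₃, k₄⟩ := key (ψ x) (ψ y) fun h => hcon ⟨hxy.ne, h⟩
  obtain ⟨z, hz, w, hw, hzw⟩ := Finset.one_lt_card.1 (hcard k)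
  simp only [mem_filter, mem_univ, true_and] at hz hw
  have hadj : ∀ u t, u ≠ t → (ψ u = ψ t ∨ ψ t = ψ u + 1 ∨ ψ u = ψ t + 1) →
      (cycleBlowUp ψ).Adj u t := fun u t h₁ h₂ => cycleBlowUp_adj.2 ⟨h₁, h₂⟩
  have hne : ∀ u t, ψ u ≠ ψ t → u ≠ t := fun u t h₁ h₂ => h₁ (congrArg ψ h₂)
  have g₁ := hle (hadj x z (hne _ _ (by rwa [hz])) (Or.inr (by rwa [hz])))
  have g₂ := hle (hadj x w (hne _ _ (by rwa [hw])) (Or.inr (by rwa [hw])))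
  have g₃ := hle (hadj y z (hne _ _ (by rwa [hz])) (Or.inr (by rwa [hz])))
  have g₄ := hle (hadj y w (hne _ _ (by rwa [hw])) (Or.inr (by rwa [hw])))
  have g₅ := hle (hadj z w hzw (Or.inl (by rw [hz, hw])))
  have hmem : ({x, y, z, w} : Finset V) ∈ G.cliqueFinset 4 := by
    rw [SimpleGraph.mem_cliqueFinset_iff, SimpleGraph.isNClique_iff]
    constructor
    · simp [SimpleGraph.isClique_iff, Set.pairwise_insert, g₁, g₂, g₃, g₄, g₅, hxy, hxy.symm,
        g₁.symm, g₂.symm, g₃.symm, g₄.symm, g₅.symm]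
    · rw [Finset.card_insert_of_notMem (by simp [hxy.ne, g₁.ne, g₂.ne]),
        Finset.card_eq_three.2 ⟨y, z, w, g₃.ne, g₄.ne, hzw, rfl⟩]
  rw [← heq, SimpleGraph.mem_cliqueFinset_iff] at hmem
  exact hcon (cycleBlowUp_adj.1 (hmem.isClique (by simp) (by simp) hxy.ne))

end CycleBlowUp

/-! ### Extremal graphs -/

open Finset in
open scoped Classical in
theorem exists_fin_map_card_fiber {n : ℕ} {m : Fin 5 → ℕ} (hm : ∑ i, m i = n) :
    ∃ ψ : Fin n → Fin 5, ∀ i, #{x | ψ x = i} = m i := by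
  have hcard : Fintype.card (Σ i, Fin (m i)) = Fintype.card (Fin n) := by
    simp [hm]
  set f := Fintype.equivOfCardEq hcard
  refine ⟨fun x => (f.symm x).1, fun i => ?_⟩
  rw [← Fintype.card_subtype, ← Fintype.card_fin (m i)]
  exact Fintype.card_congr
    ((f.symm.subtypeEquiv fun _ => Iff.rfl).trans (Equiv.sigmaSubtype i))

theorem cliqueCount_mono {V : Type*} [Finite V] {G H : SimpleGraph V} (h : G ≤ H) (k : ℕ) :
    cliqueCount G k ≤ cliqueCount H k :=
  Set.ncard_le_ncard (SimpleGraph.cliqueSet_mono h) (Set.toFinite _)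

open scoped Classical in
theorem cliqueCount_le_choose {V : Type*} [Fintype V] (G : SimpleGraph V) (k : ℕ) :
    cliqueCount G k ≤ (Fintype.card V).choose k := by
  rw [cliqueCount_eq_card]
  exact SimpleGraph.card_cliqueFinset_le

theorem minCliques_le_cliqueCount {n k l : ℕ} {G : SimpleGraph (Fin n)} (hG : G.IndepSetFree l) :
    minCliques n k l ≤ cliqueCount G k :=
  Nat.sInf_le ⟨G, hG, rfl⟩

open scoped Classical in
theorem minCliques_le_blowUpCount {n : ℕ} (hn : 5 ≤ n) :
    (minCliques n 4 3 : ℤ) ≤ blowUpCount (partSizes n) := by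
  obtain ⟨ψ, hψ⟩ := exists_fin_map_card_fiber (sum_partSizes hn)
  have h := minCliques_le_cliqueCount (k := 4) (indepSetFree_cycleBlowUp ψ)
  have h₂ := cliqueCount_cycleBlowUp ψ
  simp only [hψ] at h₂
  calc (minCliques n 4 3 : ℤ) ≤ cliqueCount (cycleBlowUp ψ) 4 := by exact_mod_cast h
    _ = _ := h₂

open Finset in
open scoped Classical in
-- Upper bound and coincidences give K = 25 · (2 + 6) = 200, so the chosen path has `pathStat` at
-- most 5250000n². The size of n is dictated by the degree deviations: 5250000n must not exceed (n /
-- (20 · 10⁶))².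
theorem exists_hom_of_minimal {n : ℕ} (hn : 10 ^ 22 ≤ n) {G : SimpleGraph (Fin n)}
    (hG : G.IndepSetFree 3) (hmin : cliqueCount G 4 = minCliques n 4 3) :
    ∃ φ : Fin n → Fin 5, (∀ x y, complAdj G x y = true → φ y = φ x + 1 ∨ φ x = φ y + 1) ∧
      ∀ i, |(#{x | φ x = i} : ℝ) - n / 5| ≤ 5 / 10 ^ 6 * n := by
  have hn7 : 10 ^ 7 ≤ n := le_trans (by norm_num) hn
  have hnR₀ : (10 : ℝ) ^ 22 ≤ n := by exact_mod_cast hn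
  have hnR : (10000000000000000000000 : ℝ) ≤ n := le_trans (by norm_num) hnR₀
  have hn0 : (0 : ℝ) < n := by linarith
  have hcard : Fintype.card (Fin n) = n := Fintype.card_fin n
  have hcount : (24 * cliqueCount G 4 : ℝ) ≤ 3 / 25 * (n : ℝ) ^ 4 + 2 * (n : ℝ) ^ 3 := by
    refine le_trans ?_ (blowUpCount_partSizes_le hn7)
    have h := minCliques_le_blowUpCount (n := n) (le_trans (by norm_num) hn)
    rw [← hmin] at h
    have h' : (cliqueCount G 4 : ℝ) ≤ blowUpCount (partSizes n) := by exact_mod_cast h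
    linarith
  have he := complAdj_comm G
  have ht := complAdj_triangle hG
  have hT : 25 * ∑ a, ∑ b, ∑ c, ∑ d, indepInd (complAdj G) a b c d ≤
      3 * (Fintype.card (Fin n) : ℤ) ^ 4 + 200 * (Fintype.card (Fin n) : ℤ) ^ 3 := by
    have h := sum_indepInd_le_cliqueCount G
    rw [hcard] at h ⊢
    have h' : ((∑ a, ∑ b, ∑ c, ∑ d, indepInd (complAdj G) a b c d : ℤ) : ℝ) ≤
        24 * cliqueCount G 4 + 6 * (n : ℝ) ^ 3 := by exact_mod_cast h
    have h₂ : (25 * (∑ a, ∑ b, ∑ c, ∑ d, indepInd (complAdj G) a b c d : ℤ) : ℝ) ≤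
        3 * (n : ℝ) ^ 4 + 200 * (n : ℝ) ^ 3 := by linarith
    exact_mod_cast h₂
  obtain ⟨a, b, c, d, hp, hstat⟩ := exists_typical_path (K := 200) (by norm_num) he ht
    (by rw [hcard]; exact_mod_cast le_trans (by norm_num) hn) hT
  have hstat' : ((pathStat (complAdj G) a b c d : ℤ) : ℝ) ≤ 5250000 * (n : ℝ) ^ 2 := by
    rw [hcard] at hstat
    norm_num at hstat
    exact_mod_cast hstat
  have hD := defectInd_nonneg (complAdj G)
  have p₁ : 0 ≤ ∑ x, defectInd (complAdj G) a b c d x + ∑ x, defectInd (complAdj G) d c b a x :=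
    add_nonneg (Finset.sum_nonneg fun x _ => hD _ _ _ _ _)
      (Finset.sum_nonneg fun x _ => hD _ _ _ _ _)
  have p₂ : 0 ≤ ∑ x, ∑ y, defectInd (complAdj G) x b a y d +
      ∑ x, ∑ y, defectInd (complAdj G) a x c d y + ∑ x, ∑ y, defectInd (complAdj G) x c d y a :=
    add_nonneg (add_nonneg
      (Finset.sum_nonneg fun x _ => Finset.sum_nonneg fun y _ => hD _ _ _ _ _)
      (Finset.sum_nonneg fun x _ => Finset.sum_nonneg fun y _ => hD _ _ _ _ _))
      (Finset.sum_nonneg fun x _ => Finset.sum_nonneg fun y _ => hD _ _ _ _ _)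
  have hS : ∃ S, NearBlowUp (complAdj G) (20 * (1 / (20 * 10 ^ 6))) S := by
    refine exists_nearBlowUp_of_path (by norm_num) (by norm_num) he ht
      (by rw [hcard]; omega) hp ?_ ?_ ?_
    all_goals
      unfold pathStat at hstat'
      generalize (∑ x, defectInd (complAdj G) a b c d x +
        ∑ x, defectInd (complAdj G) d c b a x) = X at *
      generalize (∑ x, ∑ y, defectInd (complAdj G) x b a y d +
        ∑ x, ∑ y, defectInd (complAdj G) a x c d y +
        ∑ x, ∑ y, defectInd (complAdj G) x c d y a) = Y at *
      have p₁' : (0 : ℝ) ≤ X := by exact_mod_cast p₁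
      have p₂' : (0 : ℝ) ≤ Y := by exact_mod_cast p₂
      rw [hcard] at hstat' ⊢
      push_cast at hstat'
      have q₁ : (0 : ℝ) ≤ (n : ℝ) ^ 2 * X := by positivity
      have q₂ : (0 : ℝ) ≤ (n : ℝ) * Y := by positivity
      have qa := sq_nonneg (degDev (complAdj G) a : ℝ)
      have qb := sq_nonneg (degDev (complAdj G) b : ℝ)
      have qc := sq_nonneg (degDev (complAdj G) c : ℝ)
      have qd := sq_nonneg (degDev (complAdj G) d : ℝ)
    · intro x hx
      have hx2 : (n : ℝ) * (degDev (complAdj G) x : ℝ) ^ 2 ≤ 5250000 * (n : ℝ) ^ 2 := by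
        refine le_trans ?_ hstat'
        have : (degDev (complAdj G) x : ℝ) ^ 2 ≤ degDev (complAdj G) a ^ 2 +
            degDev (complAdj G) b ^ 2 + degDev (complAdj G) c ^ 2 + degDev (complAdj G) d ^ 2 := by
          rcases hx with rfl | rfl | rfl | rfl <;> linarith
        have := mul_le_mul_of_nonneg_left this hn0.le
        linarith
      refine abs_le_of_sq_le_sq ?_ (by positivity)
      refine le_of_mul_le_mul_left (hx2.trans ?_) hn0
      have : (n : ℝ) * (1 / (20 * 10 ^ 6) * n) ^ 2 = (n : ℝ) ^ 2 * (n / (20 * 10 ^ 6) ^ 2) := by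
        ring
      rw [this, mul_comm]
      refine mul_le_mul_of_nonneg_left ?_ (by positivity)
      norm_num
      linarith
    · have h₁ : (n : ℝ) ^ 2 * X ≤ (n : ℝ) ^ 2 * 5250000 := by
        have : (0 : ℝ) ≤ n * ((degDev (complAdj G) a : ℝ) ^ 2 + degDev (complAdj G) b ^ 2 +
          degDev (complAdj G) c ^ 2 + degDev (complAdj G) d ^ 2) := by positivity
        linarith
      have h₂ := le_of_mul_le_mul_left h₁ (by positivity)
      norm_num
      linarith
    · have h₁ : (n : ℝ) * Y ≤ (n : ℝ) * (5250000 * n) := by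
        have : (0 : ℝ) ≤ n * ((degDev (complAdj G) a : ℝ) ^ 2 + degDev (complAdj G) b ^ 2 +
          degDev (complAdj G) c ^ 2 + degDev (complAdj G) d ^ 2) := by positivity
        linarith
      have h₂ := le_of_mul_le_mul_left h₁ hn0
      norm_num
      nlinarith
  obtain ⟨S, hS⟩ := hS
  rw [show (20 * (1 / (20 * 10 ^ 6)) : ℝ) = 1 / 10 ^ 6 by norm_num] at hS
  obtain ⟨φ, h₁, h₂⟩ := hS.exists_hom (by rw [hcard]; omega) ht fun v => by
    have h := sum_indepInd_le_of_minimal hG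
      (fun G' hG' => hmin.trans_le (minCliques_le_cliqueCount hG')) v
    rw [hcard] at h ⊢
    have h' : (n : ℝ) * ((∑ x, ∑ y, ∑ z, indepInd (complAdj G) v x y z : ℤ) : ℝ) ≤
        24 * cliqueCount G 4 + 12 * (n : ℝ) ^ 3 := by exact_mod_cast h
    refine le_of_mul_le_mul_left (h'.trans ?_) hn0
    have : (14000 : ℝ) * (n : ℝ) ^ 3 ≤ n * (n : ℝ) ^ 3 :=
      mul_le_mul_of_nonneg_right (by linarith) (by positivity)
    have e₁ : (n : ℝ) * (121 / 1000 * (n : ℝ) ^ 3) = 121 / 1000 * (n * (n : ℝ) ^ 3) := by ring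
    have e₂ : (n : ℝ) ^ 4 = n * (n : ℝ) ^ 3 := by ring
    rw [e₁]
    rw [e₂] at hcount
    linarith
  refine ⟨φ, h₁, fun i => ?_⟩
  have := h₂ i
  rw [hcard] at this
  convert this using 2

open Finset in
open scoped Classical in
theorem exists_cycleBlowUp_le_of_minimal {n : ℕ} (hn : 10 ^ 22 ≤ n) {G : SimpleGraph (Fin n)}
    (hG : G.IndepSetFree 3) (hmin : cliqueCount G 4 = minCliques n 4 3) :
    ∃ ψ : Fin n → Fin 5, (∀ i, #{x | ψ x = i} = partSizes n i) ∧ cycleBlowUp ψ ≤ G := by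
  obtain ⟨φ, h₁, h₂⟩ := exists_hom_of_minimal hn hG hmin
  replace hn : 10 ^ 7 ≤ n := le_trans (by norm_num) hn
  have hn5 : 5 ≤ n := le_trans (by norm_num) hn
  have hle : ∀ ψ : Fin n → Fin 5,
      (∀ x y, φ y = φ x + 1 ∨ φ x = φ y + 1 →
        ¬(ψ x = ψ y ∨ ψ y = ψ x + 1 ∨ ψ x = ψ y + 1)) → cycleBlowUp ψ ≤ G := by
    intro ψ h x y hxy
    rw [cycleBlowUp_adj] at hxy
    refine adj_of_complAdj_eq_false ?_ hxy.1
    by_contra hc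
    exact h x y (h₁ x y ((Bool.not_eq_false _).mp hc)) hxy.2
  -- Multiplication by 2 exchanges C₅ and its complement. Vertices in equal or adjacent parts for
  -- `ψ` have equal or non-consecutive values of `φ`, so they are adjacent in `G`.
  set ψ : Fin n → Fin 5 := fun x => 2 * φ x with hψ
  have hψle := hle ψ fun x y hxy => by
    have key : ∀ i j : Fin 5, j = i + 1 ∨ i = j + 1 →
        ¬(2 * i = 2 * j ∨ 2 * j = 2 * i + 1 ∨ 2 * i = 2 * j + 1) := by decide
    exact key _ _ hxy
  have hfib : ∀ i, (#{x | ψ x = i}) = #{x | φ x = 3 * i} := by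
    intro i
    refine congrArg Finset.card (Finset.filter_congr fun x _ => ?_)
    exact (by decide : ∀ i j : Fin 5, 2 * j = i ↔ j = 3 * i) i (φ x)
  have hcount : blowUpCount (fun i => #{x | ψ x = i}) ≤ blowUpCount (partSizes n) := by
    rw [← cliqueCount_cycleBlowUp]
    refine le_trans ?_ (minCliques_le_blowUpCount hn5)
    rw [← hmin]
    exact Int.ofNat_le.2 (cliqueCount_mono hψle 4)
  have hsum : ∑ i, #{x | ψ x = i} = n := by
    have := Finset.card_eq_sum_card_fiberwise (f := ψ) (s := univ) (t := univ) (fun x _ => by simp)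
    rw [← this, Finset.card_univ, Fintype.card_fin]
  obtain ⟨c, hc | hc⟩ := eq_partSizes_of_blowUpCount_le (le_trans (by norm_num) hn) hsum
    (fun i => by rw [hfib]; exact h₂ (3 * i)) hcount
  · refine ⟨fun x => ψ x + c, fun i => ?_, hle _ fun x y hxy => ?_⟩
    · have h := hc (i - c)
      rw [sub_add_cancel] at h
      rw [← h]
      exact congrArg Finset.card (Finset.filter_congr fun x _ => eq_sub_iff_add_eq.symm)
    · have key : ∀ c i j : Fin 5, j = i + 1 ∨ i = j + 1 →
          ¬(2 * i + c = 2 * j + c ∨ 2 * j + c = 2 * i + c + 1 ∨ 2 * i + c = 2 * j + c + 1) := by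
        decide
      exact key _ _ _ hxy
  · refine ⟨fun x => c - ψ x, fun i => ?_, hle _ fun x y hxy => ?_⟩
    · have h := hc (c - i)
      rw [sub_sub_cancel] at h
      rw [← h]
      refine congrArg Finset.card (Finset.filter_congr fun x _ => ?_)
      exact (by decide : ∀ c i j : Fin 5, c - j = i ↔ j = c - i) c i (ψ x)
    · have key : ∀ c i j : Fin 5, j = i + 1 ∨ i = j + 1 →
          ¬(c - 2 * i = c - 2 * j ∨ c - 2 * j = c - 2 * i + 1 ∨ c - 2 * i = c - 2 * j + 1) := by
        decide
      exact key _ _ _ hxy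

open scoped Classical in
-- The blow-up contained in `G` has no independent triple, so its clique count lies between the
-- minimum and that of `G`. Both are equal, and `G` has no further edge.
theorem extremal_iff {n : ℕ} (hn : 10 ^ 22 ≤ n) {G : SimpleGraph (Fin n)}
    (hG : G.IndepSetFree 3) (hmin : cliqueCount G 4 = minCliques n 4 3) :
    (minCliques n 4 3 : ℤ) = blowUpCount (partSizes n) ∧
      Nonempty (G ≃g blowUp (SimpleGraph.cycleGraph 5) (partSizes n)) := by
  obtain ⟨ψ, h₁, h₂⟩ := exists_cycleBlowUp_le_of_minimal hn hG hmin
  replace hn : 25 ≤ n := le_trans (by norm_num) hn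
  have hn5 : 5 ≤ n := le_trans (by norm_num) hn
  have hcount := cliqueCount_cycleBlowUp ψ
  simp only [h₁] at hcount
  have h₃ := minCliques_le_blowUpCount hn5
  have h₄ : minCliques n 4 3 ≤ cliqueCount (cycleBlowUp ψ) 4 :=
    minCliques_le_cliqueCount (indepSetFree_cycleBlowUp ψ)
  have h₅ : cliqueCount (cycleBlowUp ψ) 4 ≤ cliqueCount G 4 :=
    cliqueCount_mono h₂ 4
  have h₆ : cliqueCount (cycleBlowUp ψ) 4 = minCliques n 4 3 :=
    le_antisymm (h₅.trans_eq hmin) h₄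
  refine ⟨by rw [← h₆, hcount], ?_⟩
  have hG' : G = cycleBlowUp ψ := by
    refine eq_cycleBlowUp_of_cliqueCount_le h₂ (fun i => ?_) (by rw [h₆, hmin])
    rw [h₁]
    have hp := partSizes_eq hn5 i
    have hd := (abs_le.1 (abs_sizeDev_le (n % 5) i)).1
    have hk : 4 ≤ n / 5 := by omega
    omega
  rw [hG']
  exact nonempty_iso_blowUp h₁

/-! ### The asymptotic value and the main theorem -/

theorem minCliques_lower_bound (n : ℕ) :
    3 / 25 * (n : ℝ) ^ 4 ≤ 24 * minCliques n 4 3 + 6 * (n : ℝ) ^ 3 := by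
  rcases Nat.eq_zero_or_pos n with rfl | hn
  · simp
  have hn0 : (0 : ℝ) < n := by exact_mod_cast hn
  obtain ⟨G, hG, hmin⟩ := minCliques_attained n 4 3 (by norm_num)
  have h := indep_quadruple_bound (complAdj_comm G) (complAdj_triangle hG)
  have h₂ := sum_indepInd_le_cliqueCount G
  rw [hmin] at h₂
  have hB : 0 ≤ ∑ a, ∑ b, ∑ c, ∑ d, ∑ x, defectInd (complAdj G) a b c d x :=
    Finset.sum_nonneg fun a _ => Finset.sum_nonneg fun b _ => Finset.sum_nonneg fun c _ =>
      Finset.sum_nonneg fun d _ => Finset.sum_nonneg fun x _ => defectInd_nonneg _ a b c d x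
  have hS : 0 ≤ ∑ a, degDev (complAdj G) a ^ 2 := Finset.sum_nonneg fun a _ => sq_nonneg _
  rw [Fintype.card_fin] at h h₂
  generalize (∑ a, ∑ b, ∑ c, ∑ d, indepInd (complAdj G) a b c d) = T at *
  have h₃ : 3 * (n : ℤ) ^ 5 ≤ 25 * n * T := by nlinarith [mul_nonneg (sq_nonneg (n : ℤ)) hS]
  have h₃' : 3 * (n : ℝ) ^ 5 ≤ 25 * n * T := by exact_mod_cast h₃
  have h₂' : (T : ℝ) ≤ 24 * minCliques n 4 3 + 6 * (n : ℝ) ^ 3 := by exact_mod_cast h₂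
  refine le_trans ?_ h₂'
  have : (n : ℝ) * (3 / 25 * (n : ℝ) ^ 4) ≤ n * T := by
    have e₁ : (n : ℝ) * (3 / 25 * (n : ℝ) ^ 4) = (3 * (n : ℝ) ^ 5) / 25 := by ring
    rw [e₁]
    linarith
  exact le_of_mul_le_mul_left this hn0

theorem exists_abs_minCliques_sub_le : ∃ C : ℝ, ∀ n : ℕ,
    |(minCliques n 4 3 : ℝ) - 3 / 25 * (n.choose 4 : ℝ)| ≤ C * (n : ℝ) ^ 3 := by
  -- For n < 10⁷ the trivial bound by n choose 4 suffices, as n⁴ ≤ 10⁷ n³; above that the blow-up is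
  -- used.
  refine ⟨10 ^ 7, fun n => ?_⟩
  have hch : (24 * (n.choose 4 : ℝ)) = n * (n - 1) * (n - 2) * (n - 3) := by
    exact_mod_cast twentyFour_mul_choose_four n
  have hn3 : (0 : ℝ) ≤ (n : ℝ) ^ 3 := by positivity
  have hn1 : (n : ℝ) ≤ (n : ℝ) ^ 2 := by
    have : n ≤ n ^ 2 := Nat.le_self_pow (by norm_num) n
    exact_mod_cast this
  have hn2 : (n : ℝ) ^ 2 ≤ (n : ℝ) ^ 3 := by
    have : n ^ 2 ≤ n ^ 3 := by
      rcases Nat.eq_zero_or_pos n with rfl | hn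
      · simp
      · exact Nat.pow_le_pow_right hn (by norm_num)
    exact_mod_cast this
  have hn0 : (0 : ℝ) ≤ n := Nat.cast_nonneg n
  have hexp : (n : ℝ) * (n - 1) * (n - 2) * (n - 3) =
      (n : ℝ) ^ 4 - 6 * (n : ℝ) ^ 3 + 11 * (n : ℝ) ^ 2 - 6 * n := by ring
  rw [hexp] at hch
  have hlow := minCliques_lower_bound n
  rw [abs_le]
  constructor
  · linarith
  · rcases le_or_gt (10 ^ 7) n with hn | hn
    · have h₁ := blowUpCount_partSizes_le hn
      have h₂ : (minCliques n 4 3 : ℝ) ≤ blowUpCount (partSizes n) := by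
        exact_mod_cast minCliques_le_blowUpCount (le_trans (by norm_num) hn)
      linarith
    · have h₁ : minCliques n 4 3 ≤ n.choose 4 := by
        have hfree : (⊤ : SimpleGraph (Fin n)).IndepSetFree 3 := by
          rw [← SimpleGraph.cliqueFree_compl, compl_top]
          exact SimpleGraph.cliqueFree_bot (by norm_num)
        refine (minCliques_le_cliqueCount hfree).trans ?_
        exact (cliqueCount_le_choose _ 4).trans_eq (by rw [Fintype.card_fin])
      have h₂ : (minCliques n 4 3 : ℝ) ≤ n.choose 4 := by exact_mod_cast h₁
      have h₃ : (n : ℝ) ≤ 10 ^ 7 := by exact_mod_cast hn.le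
      have h₄ : (n : ℝ) ^ 4 ≤ 10 ^ 7 * (n : ℝ) ^ 3 := by
        have : (n : ℝ) ^ 4 = n * (n : ℝ) ^ 3 := by ring
        rw [this]
        exact mul_le_mul_of_nonneg_right h₃ hn3
      linarith

theorem theorem1p1 :
    -- the asymptotic value: `f(n,4,3) = (3/25) * (n choose 4) + O(n^3)`
    (∃ C : ℝ, ∀ n : ℕ,
      |(minCliques n 4 3 : ℝ) - 3 / 25 * (n.choose 4 : ℝ)| ≤ C * (n : ℝ) ^ 3) ∧
    -- for large `n`, the blow-up of the 5-cycle is extremal, and it is the only extremal graph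
    (∃ N : ℕ, ∀ n : ℕ, N ≤ n →
      ∑ i, partSizes n i = n ∧
      (blowUp (SimpleGraph.cycleGraph 5) (partSizes n)).IndepSetFree 3 ∧
      cliqueCount (blowUp (SimpleGraph.cycleGraph 5) (partSizes n)) 4 = minCliques n 4 3 ∧
      ∀ G : SimpleGraph (Fin n), G.IndepSetFree 3 → cliqueCount G 4 = minCliques n 4 3 →
        Nonempty (G ≃g blowUp (SimpleGraph.cycleGraph 5) (partSizes n))) := by
  classical
  refine ⟨exists_abs_minCliques_sub_le, 10 ^ 22, fun n hn => ⟨sum_partSizes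
    (le_trans (by norm_num) hn), indepSetFree_cycleBlowUp Sigma.fst, ?_,
    fun G hG hmin => (extremal_iff hn hG hmin).2⟩⟩
  obtain ⟨G, hG, hmin⟩ := minCliques_attained n 4 3 (by norm_num)
  -- `blowUp` of C₅ is definitionally `cycleBlowUp` along the first projection, so its clique count
  -- is already known.
  have h := cliqueCount_cycleBlowUp
    (Sigma.fst : (Σ i : Fin 5, Fin (partSizes n i)) → Fin 5)
  have hfib : ∀ i, (Finset.univ.filter fun x : Σ i : Fin 5, Fin (partSizes n i) => x.1 = i).card =
      partSizes n i := by
    intro i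
    rw [← Fintype.card_subtype, Fintype.card_congr (Equiv.sigmaSubtype i), Fintype.card_fin]
  simp only [hfib] at h
  have h₂ := (extremal_iff hn hG hmin).1
  rw [← h] at h₂
  exact_mod_cast h₂.symm
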